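/- **Setting.** Let $n\in\mathbb N$, $\rho>0$, and write $L^2,H^1,H^2$ for $L^2(\mathbb R;\mathbb R^n)$, etc. Let $u_\pm\in\mathbb R^n$ and assume: * $f\in C^3(\mathbb R^n;\mathbb R^n)$, $f(u_\pm)=0$, and $D^3f$ is bounded; * $g\in C^2(\mathbb R^n;\mathbb R^n)$, $g(u_\pm)=0$, and for some $K_g>0$, $|Dg(u)|\le K_g$ and $|g(u_A)-g(u_B)|+|Dg(u_A)-Dg(u_B)|\le K_g|u_A-u_B|$ for all $u,u_A,u_B$; * $\Phi_0\in C^2(\mathbb R;\mathbb R^n)$ and $c_0\in\mathbb R$ are such that $u(x,t)=\Phi_0(x-c_0t)$ solves $u_t=\rho u_{xx}+f(u)$, and $|\Phi_0(\xi)-u_\pm|+|\Phi_0'(\xi)|\le K'e^{-\nu_\pm|\xi|}$ for $\pm\xi\ge0$, with some $K',\nu_\pm>0$; * with $\mathcal L v=\rho v''+c_0v'+Df(\Phi_0)v$ and its formal adjoint $\mathcal L^{\mathrm{adj}}w=\rho w''-c_0w'+Df(\Phi_0)^{T}w$, both from $H^2$ to $L^2$: there is $\beta>0$ such that $\mathcal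 L-\lambda$ is invertible for all $\lambda\in\mathbb C\setminus\{0\}$ with $\operatorname{Re}\lambda\ge-2\beta$; $\mathcal L$ is Fredholm of index zero; $\ker\mathcal L=\operatorname{span}\{\Phi_0'\}$ and $\ker\mathcal L^{\mathrm{adj}}=\operatorname{span}\{\psi_{\mathrm{tw}}\}$ with $\langle\Phi_0',\psi_{\mathrm{tw}}\rangle_{L^2}=1$. Put $K_{\mathrm{ip}}=[\|g(\Phi_0)\|_{L^2}+2K_g]\,\|\psi_{\mathrm{tw}}\|_{L^2}$. Let $\chi_{\mathrm{low}}:\mathbb R\to[\tfrac14,\infty)$ and $\chi_{\mathrm{high}}:\mathbb R\to[-K_{\mathrm{ip}}-1,K_{\mathrm{ip}}+1]$ be smooth and non-decreasing, with $\chi_{\mathrm{low}}(x)=\tfrac14$ for $x\le\tfrac14$, $\chi_{\mathrm{low}}(x)=x$ for $x\ge\tfrac12$, $\chi_{\mathrm{high}}(x)=x$ for $|x|\le K_{\mathrm{ip}}$, and $\chi_{\mathrm{high}}(x)=\operatorname{sign}(x)(K_{\mathrm{ip}}+1)$ for $|x|\ge K_{\mathrm{ip}}+1$. For $u\in\Phi_0+H^1$,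 $\psi\in H^1$, $c\in\mathbb R$ put $$b(u,\psi)=-\frac{\chi_{\mathrm{high}}(\langle g(u),\psi\rangle_{L^2})}{\chi_{\mathrm{low}}(\langle u',\psi\rangle_{L^2})},\qquad \kappa_\sigma(u,\psi)=1+\frac{\sigma^2}{2\rho}b(u,\psi)^2,$$ $$\mathcal J_\sigma(u,c,\psi)=\kappa_\sigma(u,\psi)^{-1}\big[f(u)+cu'+\sigma^2b(u,\psi)\,\partial_\xi[g(u)]\big].$$ For $K>0$ and $\sigma\ge0$, a *modified wave* is a pair $(\Phi,c)\in(\Phi_0+H^2)\times\mathbb R$ with $$\rho\Phi''+\mathcal J_\sigma(\Phi,c,\psi_{\mathrm{tw}})=0\quad\text{and}\quad\|\Phi-\Phi_0\|_{H^2}+|c-c_0|\le K\sigma^2,$$ where $\Phi$ is identified with its continuous representative. **Proposition.** Suppose that $g(\Phi_0)=\vartheta_0\Phi_0'$ for some $\vartheta_0\in\mathbb R$. Then for every sufficiently large $K$ there is $\delta>0$ such that the following holds for all $0\le\sigma\le\delta$. Put $$\alpha_\sigma=\Big(1+\frac{\sigma^2\vartheta_0^2}{2\rho}\Big)^{1/2},\qquad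 \Phi_\sigma(\xi)=\Phi_0(\alpha_\sigma\xi),\qquad c_\sigma=\alpha_\sigma^{-1}c_0 .$$ 1. The pair $(\Phi_\sigma,c_\sigma)$ is a modified wave. 2. It is the only one up to translation: every modified wave $(\Phi,c)$ satisfies $c=c_\sigma$ and $\Phi=\Phi_\sigma(\cdot-\gamma)$ for some $\gamma\in\mathbb R$; and if $\langle\Phi-\Phi_\sigma,\psi_{\mathrm{tw}}\rangle_{L^2}=0$, then $\Phi=\Phi_\sigma$. 3. Every modified wave $(\Phi,c)$, in particular $(\Phi_\sigma,c_\sigma)$, satisfies $$g(\Phi)=\alpha_\sigma^{-1}\vartheta_0\Phi'=-b(\Phi,\psi_{\mathrm{tw}})\Phi' .$$ -/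

import Mathlib

open MeasureTheory
open scoped ContDiff

namespace StochWave

/-- The state space `ℝⁿ` with its Euclidean norm. -/
abbrev E (n : ℕ) : Type := EuclideanSpace ℝ (Fin n)

/-- `L² = L²(ℝ; ℝⁿ)` (equivalence classes of functions). -/
abbrev L2 (n : ℕ) : Type := Lp (E n) 2 (volume : Measure ℝ)

variable {n : ℕ}

/-! ### Sobolev spaces on the line -/

/-- `w` is a weak derivative of `u` on `ℝ`: integration by parts against all
smooth compactly supported test functions. -/
structure HasWeakDeriv (u w : ℝ → E n) : Prop where
  locInt : LocallyIntegrable u volume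
  locInt_deriv : LocallyIntegrable w volume
  integral_eq : ∀ φ : ℝ → ℝ, ContDiff ℝ ∞ φ → HasCompactSupport φ →
    ∫ x, deriv φ x • u x = - ∫ x, φ x • w x

open Classical in
/-- The weak derivative `∂_ξ u` of `u` (determined almost everywhere); junk value `0` if `u` is not
weakly differentiable. -/
noncomputable def weakDeriv (u : ℝ → E n) : ℝ → E n :=
  if h : ∃ w, HasWeakDeriv u w then h.choose else 0

/-- `v ∈ H² = H²(ℝ; ℝⁿ)`: `v`, `v'` and `v''` are square integrable. -/
def MemH2 (v : ℝ → E n) : Prop :=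
  MemLp v 2 volume ∧ ∃ w, HasWeakDeriv v w ∧ MemLp w 2 volume ∧
    ∃ z, HasWeakDeriv w z ∧ MemLp z 2 volume

/-- The norm of `L²`, on functions. -/
noncomputable def normL2 (v : ℝ → E n) : ℝ := (eLpNorm v 2 volume).toReal

/-- The norm of `H²`, on functions. -/
noncomputable def normH2 (v : ℝ → E n) : ℝ :=
  Real.sqrt (normL2 v ^ 2 + normL2 (weakDeriv v) ^ 2 + normL2 (weakDeriv (weakDeriv v)) ^ 2)

/-- The inner product of `L²`, on functions. -/
noncomputable def innerL2 (u v : ℝ → E n) : ℝ := ∫ ξ, inner ℝ (u ξ) (v ξ)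

theorem HasWeakDeriv.add {u u' w w' : ℝ → E n} (h : HasWeakDeriv u w) (h' : HasWeakDeriv u' w') :
    HasWeakDeriv (u + u') (w + w') where
  locInt := h.locInt.add h'.locInt
  locInt_deriv := h.locInt_deriv.add h'.locInt_deriv
  integral_eq φ hφ hc := by
    have hd : Continuous (deriv φ) := hφ.continuous_deriv (by simp)
    simp only [Pi.add_apply, smul_add]
    rw [integral_add (h.locInt.integrable_smul_left_of_hasCompactSupport hd hc.deriv)
        (h'.locInt.integrable_smul_left_of_hasCompactSupport hd hc.deriv),
      integral_add (h.locInt_deriv.integrable_smul_left_of_hasCompactSupport hφ.continuous hc)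
        (h'.locInt_deriv.integrable_smul_left_of_hasCompactSupport hφ.continuous hc),
      h.integral_eq φ hφ hc, h'.integral_eq φ hφ hc, neg_add]

theorem HasWeakDeriv.smul {u w : ℝ → E n} (h : HasWeakDeriv u w) (a : ℝ) :
    HasWeakDeriv (a • u) (a • w) where
  locInt := h.locInt.smul a
  locInt_deriv := h.locInt_deriv.smul a
  integral_eq φ hφ hc := by
    simp only [Pi.smul_apply, smul_comm _ a]
    rw [integral_smul, integral_smul, h.integral_eq φ hφ hc, smul_neg]

theorem HasWeakDeriv.congr {u u' w : ℝ → E n} (h : HasWeakDeriv u w) (e : u =ᵐ[volume] u') :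
    HasWeakDeriv u' w where
  locInt := (locallyIntegrable_congr e).1 h.locInt
  locInt_deriv := h.locInt_deriv
  integral_eq φ hφ hc := by
    rw [← h.integral_eq φ hφ hc]
    refine integral_congr_ae ?_
    filter_upwards [e] with x hx
    rw [hx]

theorem HasWeakDeriv.zero : HasWeakDeriv (0 : ℝ → E n) 0 where
  locInt := locallyIntegrable_zero
  locInt_deriv := locallyIntegrable_zero
  integral_eq φ _ _ := by simp

theorem MemH2.congr {v v' : ℝ → E n} (h : MemH2 v) (e : v =ᵐ[volume] v') : MemH2 v' := by
  obtain ⟨h0, w, hw, h1, hz⟩ := h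
  exact ⟨(memLp_congr_ae e).1 h0, w, hw.congr e, h1, hz⟩

/-- `H²` as a linear subspace of `L²`. -/
noncomputable def H2 (n : ℕ) : Submodule ℝ (L2 n) where
  carrier := {v | MemH2 (v : ℝ → E n)}
  add_mem' {a b} ha hb := by
    obtain ⟨h0, w, hw, h1, z, hz, h2⟩ := ha
    obtain ⟨h0', w', hw', h1', z', hz', h2'⟩ := hb
    exact MemH2.congr ⟨h0.add h0', _, hw.add hw', h1.add h1', _, hz.add hz', h2.add h2'⟩
      (Lp.coeFn_add a b).symm
  zero_mem' := MemH2.congr ⟨MemLp.zero, _, HasWeakDeriv.zero, MemLp.zero, _, HasWeakDeriv.zero,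
    MemLp.zero⟩ (Lp.coeFn_zero _ _ _).symm
  smul_mem' c v hv := by
    obtain ⟨h0, w, hw, h1, z, hz, h2⟩ := hv
    exact MemH2.congr ⟨h0.const_smul c, _, hw.smul c, h1.const_smul c, _, hz.smul c,
      h2.const_smul c⟩ (Lp.coeFn_smul c v).symm

/-! ### Hypotheses on the deterministic equation and on the noise -/

/-- (Hf): `f` is `C³` with bounded third derivative and vanishes at the limits `u_±`. -/
structure Hf (f : E n → E n) (um up : E n) : Prop where
  contDiff : ContDiff ℝ 3 f
  zero_minus : f um = 0
  zero_plus : f up = 0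
  bound : ∃ Kf : ℝ, 0 < Kf ∧ ∀ u, ‖iteratedFDeriv ℝ 3 f u‖ ≤ Kf

/-- (HTw): `u(x, t) = Φ₀(x - c₀ t)` is a travelling wave solution of `u_t = ρ u_xx + f(u)` that
approaches `u_±` at exponential rates. -/
structure HTw (ρ : ℝ) (f : E n → E n) (um up : E n) (Φ₀ : ℝ → E n) (c₀ : ℝ) : Prop where
  contDiff : ContDiff ℝ 2 Φ₀
  pde : ∀ x t : ℝ, deriv (fun s => Φ₀ (x - c₀ * s)) t =
    ρ • iteratedDeriv 2 (fun y => Φ₀ (y - c₀ * t)) x + f (Φ₀ (x - c₀ * t))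
  decay : ∃ K νm νp : ℝ, 0 < K ∧ 0 < νm ∧ 0 < νp ∧
    (∀ ξ ≤ 0, ‖Φ₀ ξ - um‖ + ‖deriv Φ₀ ξ‖ ≤ K * Real.exp (-νm * |ξ|)) ∧
    (∀ ξ, 0 ≤ ξ → ‖Φ₀ ξ - up‖ + ‖deriv Φ₀ ξ‖ ≤ K * Real.exp (-νp * |ξ|))

/-- (Hg): `g` is `C²`, vanishes at `u_±`, and `g`, `Dg` are Lipschitz with `Dg` bounded, with the
constant `Kg`. -/
structure Hg (g : E n → E n) (um up : E n) (Kg : ℝ) : Prop where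
  contDiff : ContDiff ℝ 2 g
  zero_minus : g um = 0
  zero_plus : g up = 0
  pos : 0 < Kg
  bound : ∀ u, ‖fderiv ℝ g u‖ ≤ Kg
  lipschitz : ∀ uA uB, ‖g uA - g uB‖ + ‖fderiv ℝ g uA - fderiv ℝ g uB‖ ≤ Kg * ‖uA - uB‖

/-- `L : H² → L²` is the differential operator `v ↦ c v' + ρ v'' + B v` with matrix-valued
coefficient `B`. This determines `L`. -/
def ActsAs (L : H2 n →ₗ[ℝ] L2 n) (ρ c : ℝ) (B : ℝ → E n →L[ℝ] E n) : Prop :=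
  ∀ v : H2 n, ∀ᵐ ξ : ℝ, L v ξ =
    c • weakDeriv (v : L2 n) ξ + ρ • weakDeriv (weakDeriv (v : L2 n)) ξ + B ξ ((v : L2 n) ξ)

/-- The complexification of `L - z` for `z ∈ ℂ`, with `v₁ + i v₂` written as the pair
`(v₁, v₂)`. -/
noncomputable def complexShift (L : H2 n →ₗ[ℝ] L2 n) (z : ℂ) (v : H2 n × H2 n) : L2 n × L2 n :=
  (L v.1 - (z.re • (v.1 : L2 n) - z.im • (v.2 : L2 n)),
   L v.2 - (z.re • (v.2 : L2 n) + z.im • (v.1 : L2 n)))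

/-- `L` is a Fredholm operator of index zero: its kernel and its cokernel are finite-dimensional
of the same dimension. (For operators that are bounded from `H²` with its own norm to `L²`, as the
ones below are, the range is then automatically closed.) -/
def IsFredholmIndexZero (L : H2 n →ₗ[ℝ] L2 n) : Prop :=
  FiniteDimensional ℝ (LinearMap.ker L) ∧ FiniteDimensional ℝ (L2 n ⧸ LinearMap.range L) ∧
    Module.finrank ℝ (LinearMap.ker L) = Module.finrank ℝ (L2 n ⧸ LinearMap.range L)

/-- The kernel of `L : H² → L²` is the span of the function `w` (in particular `w ∈ H²`). -/
def KerEqSpan (L : H2 n →ₗ[ℝ] L2 n) (w : ℝ → E n) : Prop :=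
  ∃ w' : H2 n, (w' : L2 n) =ᵐ[volume] w ∧ LinearMap.ker L = Submodule.span ℝ {w'}

/-- (HS): spectral stability of the wave. Here `L` is the linearisation
`v ↦ c₀ v' + ρ v'' + Df(Φ₀) v` and `Ladj` is its formal adjoint
`w ↦ - c₀ w' + ρ w'' + Df(Φ₀)ᵀ w`. Invertibility of `L - z` is bijectivity
(the inverse is then bounded by the open mapping theorem). -/
def HS (ρ : ℝ) (f : E n → E n) (Φ₀ : ℝ → E n) (c₀ : ℝ) (ψ : ℝ → E n) : Prop :=
  ∃ L Ladj : H2 n →ₗ[ℝ] L2 n,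
    ActsAs L ρ c₀ (fun ξ => fderiv ℝ f (Φ₀ ξ)) ∧
    ActsAs Ladj ρ (-c₀) (fun ξ => ContinuousLinearMap.adjoint (fderiv ℝ f (Φ₀ ξ))) ∧
    (∃ β : ℝ, 0 < β ∧ ∀ z : ℂ, z ≠ 0 → -2 * β ≤ z.re → Function.Bijective (complexShift L z)) ∧
    IsFredholmIndexZero L ∧
    KerEqSpan L (deriv Φ₀) ∧
    KerEqSpan Ladj ψ ∧
    innerL2 (deriv Φ₀) ψ = 1

/-! ### Cut-offs and the nonlinearities -/

/-- The constant `K_ip`. -/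
noncomputable def Kip (g : E n → E n) (Kg : ℝ) (Φ₀ ψ : ℝ → E n) : ℝ :=
  (normL2 (fun ξ => g (Φ₀ ξ)) + 2 * Kg) * normL2 ψ

/-- Admissible lower cut-off functions `χ_low`. -/
structure IsCutoffLow (χ : ℝ → ℝ) : Prop where
  contDiff : ContDiff ℝ ∞ χ
  monotone : Monotone χ
  range : ∀ x, 1 / 4 ≤ χ x
  eq_low : ∀ x ≤ 1 / 4, χ x = 1 / 4
  eq_self : ∀ x, 1 / 2 ≤ x → χ x = x

/-- Admissible upper cut-off functions `χ_high` with threshold `k`. -/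
structure IsCutoffHigh (k : ℝ) (χ : ℝ → ℝ) : Prop where
  contDiff : ContDiff ℝ ∞ χ
  monotone : Monotone χ
  range : ∀ x, χ x ∈ Set.Icc (-k - 1) (k + 1)
  eq_self : ∀ x, |x| ≤ k → χ x = x
  eq_high : ∀ x, k + 1 ≤ |x| → χ x = Real.sign x * (k + 1)

/-- `b(u, ψ)`. -/
noncomputable def b (χlow χhigh : ℝ → ℝ) (g : E n → E n) (u ψ : ℝ → E n) : ℝ :=
  -((χlow (innerL2 (weakDeriv u) ψ))⁻¹ * χhigh (innerL2 (fun ξ => g (u ξ)) ψ))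

/-- `κ_σ(u, ψ)`. -/
noncomputable def kappa (χlow χhigh : ℝ → ℝ) (ρ : ℝ) (g : E n → E n) (σ : ℝ) (u ψ : ℝ → E n) : ℝ :=
  1 + 1 / (2 * ρ) * σ ^ 2 * b χlow χhigh g u ψ ^ 2

/-- `𝒥_σ(u, c, ψ)`. -/
noncomputable def J (χlow χhigh : ℝ → ℝ) (ρ : ℝ) (f g : E n → E n) (σ : ℝ) (u : ℝ → E n) (c : ℝ)
    (ψ : ℝ → E n) (ξ : ℝ) : E n :=
  (kappa χlow χhigh ρ g σ u ψ)⁻¹ •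
    (f (u ξ) + c • weakDeriv u ξ +
      (σ ^ 2 * b χlow χhigh g u ψ) • weakDeriv (fun ζ => g (u ζ)) ξ)

/-- `(Φ, c)` is a modified wave for the noise level `σ`: it lies in `(Φ₀ + H²) × ℝ`, solves
`ρ Φ'' + 𝒥_σ(Φ, c, ψ) = 0` in `L²` and is `K σ²`-close to `(Φ₀, c₀)`.
The elements of `Φ₀ + H²` are identified with their continuous representatives. -/
structure IsModifiedWave (χlow χhigh : ℝ → ℝ) (ρ : ℝ) (f g : E n → E n) (Φ₀ : ℝ → E n) (c₀ : ℝ)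
    (ψ : ℝ → E n) (K σ : ℝ) (Φ : ℝ → E n) (c : ℝ) : Prop where
  continuous : Continuous Φ
  memH2 : MemH2 (Φ - Φ₀)
  eqn : ∀ᵐ ξ : ℝ, ρ • weakDeriv (weakDeriv Φ) ξ + J χlow χhigh ρ f g σ Φ c ψ ξ = 0
  bound : normH2 (Φ - Φ₀) + |c - c₀| ≤ K * σ ^ 2

end StochWave

/-!
The proof treats the number `b = b(Φ, ψ)` of a modified wave as one more unknown. Because `g(Φ₀)` is
a multiple of `Φ₀'`, a dilation `U(ξ) = Φ₀(α (ξ - γ))` satisfies `g(U) = α⁻¹ θ₀ U'` exactly, so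
`b(U, ψ) = -α⁻¹ θ₀` for every small translation `γ`, and the value of `α` is the one for which the
noise terms in the profile equation cancel against the change of `ρ U''`
(`Profile.dilate_ode`). The exponential decay of the profile makes `U - Φ₀` of order `σ²` in `H²`
when `γ = 0`, which gives the existence part (`Profile.exists_isModifiedWave_dilate`).

For uniqueness, let `(Φ, c)` be a modified wave. It is a classical `C²` solution
(`IsModifiedWave.exists_classical`), and by the intermediate value theorem some small `γ` makes
`v = Φ - U` orthogonal to `ψ` (`Profile.exists_phase`). Subtracting the two profile equations gives
`L v + (c - α⁻¹ c₀) Φ₀' = R`, where `R` is bounded pointwise by a small factor times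
`|v| + |v'| + |v''|` plus an exponentially decaying weight multiplied by `|c - α⁻¹ c₀|` and by the
difference of the two values of `b` (`norm_remainder_le`). That difference is in turn bounded by the
`H¹` norm of `v`, because `g(U)` is proportional to `U'` (`abs_b_sub_le`); no translation invariance
of `b` is needed. The spectral hypotheses say that
`(v, a) ↦ (L v + a Φ₀', ⟨v, ψ⟩)` is a continuous bijection from `H² × ℝ` onto `L² × ℝ`, hence it has
a bounded inverse (`exists_coercive`), and the small remainder is absorbed: `v = 0` and
`c = α⁻¹ c₀` (`Profile.exists_rigid`). If `⟨Φ - Φ_σ, ψ⟩ = 0` the same argument runs with `γ = 0`.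
-/

namespace StochWave

open Set Filter Topology

/-! ### Weak derivatives and primitives -/

section

section Primitive

theorem intervalIntegrable_of_locallyIntegrable {F : Type*} [NormedAddCommGroup F] {w : ℝ → F}
    (hw : LocallyIntegrable w volume) (a b : ℝ) : IntervalIntegrable w volume a b :=
  intervalIntegrable_iff.mpr <|
    (hw.integrableOn_isCompact isCompact_uIcc).mono_set uIoc_subset_uIcc

variable {F : Type*} [NormedAddCommGroup F] [NormedSpace ℝ F]

/-- `u` is locally absolutely continuous with derivative `w`: it is a primitive of the locally
integrable function `w`. -/
structure IsPrimitive (u w : ℝ → F) : Prop where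
  locInt : LocallyIntegrable w volume
  eq : ∀ x, u x = u 0 + ∫ t in (0 : ℝ)..x, w t

theorem isPrimitive_const_add (c : F) {w : ℝ → F} (hw : LocallyIntegrable w volume) :
    IsPrimitive (fun x => c + ∫ t in (0 : ℝ)..x, w t) w :=
  ⟨hw, fun x => by simp⟩

theorem IsPrimitive.continuous {u w : ℝ → F} (h : IsPrimitive u w) : Continuous u := by
  have : Continuous fun x => u 0 + ∫ t in (0 : ℝ)..x, w t :=
    continuous_const.add (intervalIntegral.continuous_primitive
      (fun a b => intervalIntegrable_of_locallyIntegrable h.locInt a b) 0)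
  exact this.congr fun x => (h.eq x).symm

theorem isPrimitive_of_hasDerivAt [CompleteSpace F] {u w : ℝ → F} (hw : Continuous w)
    (hd : ∀ x, HasDerivAt u (w x) x) : IsPrimitive u w where
  locInt := hw.locallyIntegrable
  eq x := by
    rw [intervalIntegral.integral_eq_sub_of_hasDerivAt (fun t _ => hd t)
      (hw.intervalIntegrable _ _)]
    abel

theorem IsPrimitive.hasDerivAt [CompleteSpace F] {u w : ℝ → F} (h : IsPrimitive u w)
    (hw : Continuous w) (x : ℝ) : HasDerivAt u (w x) x := by
  have := (intervalIntegral.integral_hasDerivAt_right (hw.intervalIntegrable 0 x)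
    hw.stronglyMeasurable.stronglyMeasurableAtFilter hw.continuousAt).const_add (u 0)
  exact this.congr_of_eventuallyEq (Eventually.of_forall h.eq)

theorem IsPrimitive.congr_deriv {u w w' : ℝ → F} (h : IsPrimitive u w) (e : w =ᵐ[volume] w') :
    IsPrimitive u w' where
  locInt := (locallyIntegrable_congr e).1 h.locInt
  eq x := by
    rw [h.eq x]
    congr 1
    exact intervalIntegral.integral_congr_ae (by filter_upwards [e] with t ht _ using ht)

theorem IsPrimitive.clm_comp {G : Type*} [NormedAddCommGroup G] [NormedSpace ℝ G]
    [CompleteSpace F] [CompleteSpace G] {u w : ℝ → F}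
    (h : IsPrimitive u w) (A : F →L[ℝ] G) : IsPrimitive (fun x => A (u x)) (fun x => A (w x)) where
  locInt := fun x => by
    obtain ⟨s, hs, hi⟩ := h.locInt x
    exact ⟨s, hs, A.integrable_comp hi⟩
  eq x := by
    rw [h.eq x, map_add, A.intervalIntegral_comp_comm
      (intervalIntegrable_of_locallyIntegrable h.locInt 0 x)]

/-- Integration by parts for locally absolutely continuous functions. -/
theorem IsPrimitive.integral_mul_eq_sub {u w u' w' : ℝ → ℝ} (h : IsPrimitive u w)
    (h' : IsPrimitive u' w') (a b : ℝ) :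
    ∫ x in a..b, (w x * u' x + u x * w' x) = u b * u' b - u a * u' a := by
  have key : ∀ {u w : ℝ → ℝ}, IsPrimitive u w →
      AbsolutelyContinuousOnInterval u a b ∧ (∀ᵐ x, deriv u x = w x) := by
    intro u w h
    have e : u = fun x => u a + ∫ t in a..x, w t := by
      funext x
      rw [h.eq x, h.eq a, add_assoc, intervalIntegral.integral_add_adjacent_intervals]
      all_goals exact intervalIntegrable_of_locallyIntegrable h.locInt _ _
    constructor
    · rw [e]
      have h1 : AbsolutelyContinuousOnInterval (fun _ : ℝ => u a) a b :=
        (contDiff_const (n := 1)).contDiffOn.absolutelyContinuousOnInterval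
      exact h1.add ((intervalIntegrable_of_locallyIntegrable h.locInt a b
        ).absolutelyContinuousOnInterval_intervalIntegral (c := a) (by simp))
    · filter_upwards [_root_.LocallyIntegrable.ae_hasDerivAt_integral h.locInt] with x hx
      rw [e]
      exact ((hx a).const_add (u a)).deriv
  obtain ⟨h1, h2⟩ := key h
  obtain ⟨h1', h2'⟩ := key h'
  rw [← h1.integral_deriv_mul_eq_sub h1']
  refine intervalIntegral.integral_congr_ae ?_
  filter_upwards [h2, h2'] with x hx hx' _
  rw [hx, hx']

/-- Integration by parts on the line without boundary terms. The boundary values `u u'` have limits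
at `±∞`, as `(u u')'` is integrable, and the limits vanish because `u u'` is integrable. -/
theorem IsPrimitive.integral_mul_eq_zero {u w u' w' : ℝ → ℝ} (h : IsPrimitive u w)
    (h' : IsPrimitive u' w') (hi : Integrable fun x => u x * u' x)
    (hi1 : Integrable fun x => w x * u' x + u x * w' x) :
    ∫ x, (w x * u' x + u x * w' x) = 0 := by
  set G := fun x => u x * u' x with hG
  set H := fun x => w x * u' x + u x * w' x with hH
  have key : ∀ b, G b = G 0 + ∫ x in (0 : ℝ)..b, H x := fun b => by
    rw [h.integral_mul_eq_sub h' 0 b]; simp [hG]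
  have key' : ∀ b, G b = G 0 - ∫ x in b..(0 : ℝ), H x := fun b => by
    rw [h.integral_mul_eq_sub h' b 0]; simp [hG]
  have top : Tendsto G atTop (𝓝 (G 0 + ∫ x in Ioi (0 : ℝ), H x)) := by
    rw [show G = fun b => G 0 + ∫ x in (0 : ℝ)..b, H x from funext key]
    simp only [intervalIntegral.integral_same, add_zero]
    exact (intervalIntegral_tendsto_integral_Ioi 0 hi1.integrableOn tendsto_id).const_add _
  have bot : Tendsto G atBot (𝓝 (G 0 - ∫ x in Iic (0 : ℝ), H x)) := by
    rw [show G = fun b => G 0 - ∫ x in b..(0 : ℝ), H x from funext key']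
    simp only [intervalIntegral.integral_same, sub_zero]
    exact (intervalIntegral_tendsto_integral_Iic 0 hi1.integrableOn tendsto_id).const_sub _
  have t0 : G 0 + ∫ x in Ioi (0 : ℝ), H x = 0 := by
    refine IntegrableAtFilter.eq_zero_of_tendsto (μ := volume)
      ⟨univ, univ_mem, hi.integrableOn⟩ ?_ top
    intro s hs
    obtain ⟨b, hb⟩ := mem_atTop_sets.1 hs
    exact measure_mono_top (fun x hx => hb x hx) Real.volume_Ici
  have b0 : G 0 - ∫ x in Iic (0 : ℝ), H x = 0 := by
    refine IntegrableAtFilter.eq_zero_of_tendsto (μ := volume)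
      ⟨univ, univ_mem, hi.integrableOn⟩ ?_ bot
    intro s hs
    obtain ⟨b, hb⟩ := mem_atBot_sets.1 hs
    exact measure_mono_top (fun x hx => hb x hx) Real.volume_Iic
  rw [← intervalIntegral.integral_Iic_add_Ioi (b := 0) hi1.integrableOn hi1.integrableOn]
  linarith

end Primitive

variable {n : ℕ}

theorem isPrimitive_coord {u w : ℝ → E n} (h : IsPrimitive u w) (i : Fin n) :
    IsPrimitive (fun x => u x i) (fun x => w x i) :=
  h.clm_comp (EuclideanSpace.proj i : E n →L[ℝ] ℝ)

theorem integral_coord {h : ℝ → E n} (hi : Integrable h) (i : Fin n) :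
    (∫ x, h x) i = ∫ x, h x i :=
  ((EuclideanSpace.proj i : E n →L[ℝ] ℝ).integral_comp_comm hi).symm

theorem IsPrimitive.hasWeakDeriv {u w : ℝ → E n} (h : IsPrimitive u w) : HasWeakDeriv u w where
  locInt := h.continuous.locallyIntegrable
  locInt_deriv := h.locInt
  integral_eq φ hφ hc := by
    have hd : Continuous (deriv φ) := hφ.continuous_deriv (by simp)
    have i1 := h.continuous.locallyIntegrable.integrable_smul_left_of_hasCompactSupport
      (μ := volume) hd hc.deriv
    have i2 := h.locInt.integrable_smul_left_of_hasCompactSupport hφ.continuous hc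
    have i0 := h.continuous.locallyIntegrable.integrable_smul_left_of_hasCompactSupport
      (μ := volume) hφ.continuous hc
    have pφ : IsPrimitive φ (deriv φ) := isPrimitive_of_hasDerivAt hd
      fun x => ((hφ.differentiable (by simp)) x).hasDerivAt
    rw [eq_neg_iff_add_eq_zero, ← integral_add i1 i2]
    ext i
    rw [show ∫ x, (deriv φ x • u x + φ x • w x) = ∫ x, ((fun x => deriv φ x • u x) +
      fun x => φ x • w x) x from rfl, integral_coord (i1.add i2)]
    have := pφ.integral_mul_eq_zero (isPrimitive_coord h i)
      ((EuclideanSpace.proj i : E n →L[ℝ] ℝ).integrable_comp i0)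
      ((EuclideanSpace.proj i : E n →L[ℝ] ℝ).integrable_comp (i1.add i2))
    simpa using this

theorem hasWeakDeriv_of_hasDerivAt {u w : ℝ → E n} (hw : Continuous w)
    (hd : ∀ x, HasDerivAt u (w x) x) : HasWeakDeriv u w :=
  (isPrimitive_of_hasDerivAt hw hd).hasWeakDeriv

theorem HasWeakDeriv.congr_deriv {u w w' : ℝ → E n} (h : HasWeakDeriv u w)
    (e : w =ᵐ[volume] w') : HasWeakDeriv u w' where
  locInt := h.locInt
  locInt_deriv := (locallyIntegrable_congr e).1 h.locInt_deriv
  integral_eq φ hφ hc := by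
    rw [h.integral_eq φ hφ hc]
    congr 1
    refine integral_congr_ae ?_
    filter_upwards [e] with x hx
    rw [hx]

theorem HasWeakDeriv.unique {u w w' : ℝ → E n} (h : HasWeakDeriv u w) (h' : HasWeakDeriv u w') :
    w =ᵐ[volume] w' := by
  refine ae_eq_of_integral_contDiff_smul_eq h.locInt_deriv h'.locInt_deriv fun φ hφ hc => ?_
  have := h.integral_eq φ hφ hc
  rw [h'.integral_eq φ hφ hc] at this
  exact (neg_injective this).symm

theorem HasWeakDeriv.sub {u u' w w' : ℝ → E n} (h : HasWeakDeriv u w) (h' : HasWeakDeriv u' w') :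
    HasWeakDeriv (u - u') (w - w') := by
  have := h.add (h'.smul (-1))
  simpa [sub_eq_add_neg] using this

theorem HasWeakDeriv.weakDeriv_ae {u w : ℝ → E n} (h : HasWeakDeriv u w) :
    weakDeriv u =ᵐ[volume] w := by
  have e : ∃ w, HasWeakDeriv u w := ⟨w, h⟩
  unfold weakDeriv
  rw [dif_pos e]
  exact e.choose_spec.unique h

theorem weakDeriv_ae_of_hasDerivAt {u w : ℝ → E n} (hw : Continuous w)
    (hd : ∀ x, HasDerivAt u (w x) x) : weakDeriv u =ᵐ[volume] w :=
  (hasWeakDeriv_of_hasDerivAt hw hd).weakDeriv_ae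

/-- The lemma of du Bois-Reymond. A test function `φ` differs from a multiple of a fixed bump of
integral one by the derivative of a test function. -/
theorem HasWeakDeriv.ae_const {u : ℝ → E n} (h : HasWeakDeriv u 0) :
    ∃ c : E n, u =ᵐ[volume] fun _ => c := by
  obtain ⟨η, hηc, hη, hη1⟩ : ∃ η : ℝ → ℝ, HasCompactSupport η ∧ ContDiff ℝ ∞ η ∧ ∫ x, η x = 1 := by
    let B : ContDiffBump (0 : ℝ) := ⟨1, 2, by norm_num, by norm_num⟩
    exact ⟨B.normed volume, B.hasCompactSupport_normed, B.contDiff_normed, B.integral_normed⟩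
  refine ⟨∫ x, η x • u x, ?_⟩
  refine ae_eq_of_integral_contDiff_smul_eq h.locInt
    (continuous_const.locallyIntegrable) fun φ hφ hc => ?_
  set m := ∫ x, φ x with hm
  have iφ : Integrable φ := hφ.continuous.integrable_of_hasCompactSupport hc
  have iη : Integrable η := hη.continuous.integrable_of_hasCompactSupport hηc
  set θ : ℝ → ℝ := fun x => φ x - m * η x with hθ
  have cθ : ContDiff ℝ ∞ θ := hφ.sub (contDiff_const.mul hη)
  have iθ : Integrable θ := iφ.sub (iη.const_mul m)
  have zθ : ∫ x, θ x = 0 := by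
    rw [hθ, integral_sub iφ (iη.const_mul m), integral_const_mul, hη1, ← hm]; ring
  obtain ⟨R, hR⟩ : ∃ R : ℝ, ∀ x, R ≤ |x| → θ x = 0 := by
    obtain ⟨R1, h1⟩ := hc.isCompact.isBounded.subset_closedBall (0 : ℝ)
    obtain ⟨R2, h2⟩ := hηc.isCompact.isBounded.subset_closedBall (0 : ℝ)
    refine ⟨max R1 R2 + 1, fun x hx => ?_⟩
    have hx1 : φ x = 0 := by
      by_contra hne
      have := h1 (subset_tsupport _ (Function.mem_support.2 hne))
      rw [Metric.mem_closedBall, Real.dist_eq, sub_zero] at this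
      linarith [le_max_left R1 R2]
    have hx2 : η x = 0 := by
      by_contra hne
      have := h2 (subset_tsupport _ (Function.mem_support.2 hne))
      rw [Metric.mem_closedBall, Real.dist_eq, sub_zero] at this
      linarith [le_max_right R1 R2]
    simp [hθ, hx1, hx2]
  set Θ : ℝ → ℝ := fun x => ∫ t in Iic x, θ t with hΘ
  have eΘ : ∀ x, Θ x = (∫ t in Iic (0 : ℝ), θ t) + ∫ t in (0 : ℝ)..x, θ t := fun x => by
    rw [← intervalIntegral.integral_Iic_sub_Iic iθ.integrableOn iθ.integrableOn]; simp [hΘ]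
  have dΘ : ∀ x, HasDerivAt Θ (θ x) x := fun x => by
    have := (intervalIntegral.integral_hasDerivAt_right (cθ.continuous.intervalIntegrable 0 x)
      cθ.continuous.stronglyMeasurable.stronglyMeasurableAtFilter
      cθ.continuous.continuousAt).const_add (∫ t in Iic (0 : ℝ), θ t)
    exact this.congr_of_eventuallyEq (Eventually.of_forall eΘ)
  have dΘ' : deriv Θ = θ := funext fun x => (dΘ x).deriv
  have cΘ : ContDiff ℝ ∞ Θ := by
    rw [contDiff_infty_iff_deriv, dΘ']
    exact ⟨fun x => (dΘ x).differentiableAt, cθ⟩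
  have sΘ : HasCompactSupport Θ := by
    refine HasCompactSupport.intro (isCompact_Icc (a := -|R|) (b := |R|)) fun x hx => ?_
    rw [mem_Icc, not_and_or, not_le, not_le] at hx
    rcases hx with hx | hx
    · refine setIntegral_eq_zero_of_forall_eq_zero fun t ht => hR t ?_
      have : t < -|R| := lt_of_le_of_lt ht hx
      rw [abs_of_neg (by linarith [abs_nonneg R])]
      linarith [le_abs_self R]
    · rw [hΘ]
      simp only
      rw [setIntegral_eq_integral_of_forall_compl_eq_zero, zθ]
      intro t ht
      have : x < t := not_le.1 ht
      exact hR t (by rw [abs_of_pos (by linarith [abs_nonneg R])]; linarith [le_abs_self R])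
  have e := h.integral_eq Θ cΘ sΘ
  rw [dΘ'] at e
  have i1 : Integrable fun x => φ x • u x :=
    h.locInt.integrable_smul_left_of_hasCompactSupport hφ.continuous hc
  have i2 : Integrable fun x => η x • u x :=
    h.locInt.integrable_smul_left_of_hasCompactSupport hη.continuous hηc
  have : ∫ x, θ x • u x = (∫ x, φ x • u x) - m • ∫ x, η x • u x := by
    rw [← integral_smul, ← integral_sub i1
      (show Integrable (fun x => m • η x • u x) from i2.smul m)]
    refine integral_congr_ae (Eventually.of_forall fun x => ?_)
    simp [hθ, sub_smul, mul_smul]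
  rw [this] at e
  simp only [Pi.zero_apply, smul_zero, integral_zero, neg_zero] at e
  rw [integral_smul_const, ← hm]
  exact sub_eq_zero.1 e

theorem HasWeakDeriv.exists_isPrimitive {u w : ℝ → E n} (h : HasWeakDeriv u w) :
    ∃ u' : ℝ → E n, u =ᵐ[volume] u' ∧ IsPrimitive u' w := by
  have hP := isPrimitive_const_add (0 : E n) h.locInt_deriv
  have hz := h.sub hP.hasWeakDeriv
  rw [sub_self] at hz
  obtain ⟨c, hc⟩ := hz.ae_const
  refine ⟨_, ?_, isPrimitive_const_add c h.locInt_deriv⟩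
  filter_upwards [hc] with x hx
  rw [← hx]
  simp

theorem HasWeakDeriv.isPrimitive {u w : ℝ → E n} (h : HasWeakDeriv u w) (hu : Continuous u) :
    IsPrimitive u w := by
  obtain ⟨u', e, hp⟩ := h.exists_isPrimitive
  rwa [(Continuous.ae_eq_iff_eq volume hu hp.continuous).1 e]

/-- Integration by parts in `H¹`. -/
theorem HasWeakDeriv.innerL2_eq_neg {u u' w w' : ℝ → E n} (h : HasWeakDeriv u w)
    (h' : HasWeakDeriv u' w') (mu : MemLp u 2 volume) (mw : MemLp w 2 volume)
    (mu' : MemLp u' 2 volume) (mw' : MemLp w' 2 volume) :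
    innerL2 w u' = - innerL2 u w' := by
  obtain ⟨v, e, p⟩ := h.exists_isPrimitive
  obtain ⟨v', e', p'⟩ := h'.exists_isPrimitive
  have e1 : innerL2 w u' = innerL2 w v' := integral_congr_ae (by
    filter_upwards [e'] with x hx; rw [hx])
  have e2 : innerL2 u w' = innerL2 v w' := integral_congr_ae (by
    filter_upwards [e] with x hx; rw [hx])
  have mv := (memLp_congr_ae e).1 mu
  have mv' := (memLp_congr_ae e').1 mu'
  have crd : ∀ {v : ℝ → E n}, MemLp v 2 volume → ∀ i, MemLp (fun x => v x i) 2 volume :=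
    fun hv i => (EuclideanSpace.proj i : E n →L[ℝ] ℝ).comp_memLp' hv
  have im : ∀ {v v' : ℝ → E n}, MemLp v 2 volume → MemLp v' 2 volume → ∀ i,
      Integrable fun x => v x i * v' x i := fun hv hv' i => (crd hv i).integrable_mul (crd hv' i)
  have ex : ∀ {v v' : ℝ → E n}, MemLp v 2 volume → MemLp v' 2 volume →
      innerL2 v v' = ∑ i, ∫ x, v x i * v' x i := fun {v v'} hv hv' => by
    rw [← integral_finsetSum _ fun i _ => im hv hv' i]
    refine integral_congr_ae (Eventually.of_forall fun x => ?_)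
    simp [PiLp.inner_apply, mul_comm]
  rw [e1, e2, ex mw mv', ex mv mw', eq_neg_iff_add_eq_zero, ← Finset.sum_add_distrib]
  refine Finset.sum_eq_zero fun i _ => ?_
  rw [← integral_add (im mw mv' i) (im mv mw' i)]
  exact (isPrimitive_coord p i).integral_mul_eq_zero (isPrimitive_coord p' i) (im mv mv' i)
    ((im mw mv' i).add (im mv mw' i))

end

/-! ### The inner product and norm of `L²` -/

section

section Norm

variable {F : Type*} [NormedAddCommGroup F]

/-- The `L²` norm of a function on the line, with values in any normed group; for `ℝⁿ`-valued
functions it is `normL2` by definition. As there, it has the junk value `0` when `u ∉ L²`. -/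
noncomputable def nrm (u : ℝ → F) : ℝ := (eLpNorm u 2 volume).toReal

theorem nrm_nonneg (u : ℝ → F) : 0 ≤ nrm u := ENNReal.toReal_nonneg

theorem nrm_congr {u v : ℝ → F} (e : u =ᵐ[volume] v) : nrm u = nrm v := by
  rw [nrm, nrm, eLpNorm_congr_ae e]

theorem nrm_add_le {u v : ℝ → F} (hu : MemLp u 2 volume) (hv : MemLp v 2 volume) :
    nrm (fun x => u x + v x) ≤ nrm u + nrm v := by
  unfold nrm
  rw [← ENNReal.toReal_add hu.2.ne hv.2.ne]
  exact ENNReal.toReal_mono (ENNReal.add_ne_top.2 ⟨hu.2.ne, hv.2.ne⟩)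
    (eLpNorm_add_le hu.1 hv.1 (by norm_num))

theorem nrm_smul [NormedSpace ℝ F] (a : ℝ) (u : ℝ → F) : nrm (fun x => a • u x) = |a| * nrm u := by
  unfold nrm
  rw [show (fun x => a • u x) = a • u from rfl, eLpNorm_const_smul, ENNReal.toReal_mul]
  simp

theorem nrm_norm (u : ℝ → F) : nrm (fun x => ‖u x‖) = nrm u := by
  rw [nrm, nrm, eLpNorm_norm]

theorem nrm_mono {u : ℝ → F} {h : ℝ → ℝ} (hh : MemLp h 2 volume) (hb : ∀ᵐ x, ‖u x‖ ≤ h x) :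
    nrm u ≤ nrm h :=
  ENNReal.toReal_mono hh.2.ne (eLpNorm_mono_ae_real hb)

theorem nrm_toLp {u : ℝ → F} (hu : MemLp u 2 volume) : ‖hu.toLp u‖ = nrm u :=
  Lp.norm_toLp u hu

theorem nrm_eq_zero {u : ℝ → F} (hu : MemLp u 2 volume) (h : nrm u = 0) : u =ᵐ[volume] 0 := by
  have := (ENNReal.toReal_eq_zero_iff _).1 h
  exact (eLpNorm_eq_zero_iff hu.1 (by norm_num)).1 (this.resolve_right hu.2.ne)

end Norm

variable {n : ℕ}

theorem memLp_smul (a : ℝ) {u : ℝ → E n} (hu : MemLp u 2 volume) :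
    MemLp (fun x => a • u x) 2 volume :=
  hu.const_smul a

theorem normL2_eq_nrm (u : ℝ → E n) : normL2 u = nrm u := rfl

theorem integrable_inner {u v : ℝ → E n} (hu : MemLp u 2 volume) (hv : MemLp v 2 volume) :
    Integrable fun x => inner ℝ (u x) (v x) := by
  refine (L2.integrable_inner (𝕜 := ℝ) (hu.toLp u) (hv.toLp v)).congr ?_
  filter_upwards [hu.coeFn_toLp, hv.coeFn_toLp] with x h1 h2
  rw [h1, h2]

theorem inner_toLp {u v : ℝ → E n} (hu : MemLp u 2 volume) (hv : MemLp v 2 volume) :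
    inner ℝ (hu.toLp u) (hv.toLp v) = innerL2 u v := by
  rw [L2.inner_def]
  refine integral_congr_ae ?_
  filter_upwards [hu.coeFn_toLp, hv.coeFn_toLp] with x h1 h2
  rw [h1, h2]

theorem innerL2_congr {u u' v v' : ℝ → E n} (e : u =ᵐ[volume] u') (e' : v =ᵐ[volume] v') :
    innerL2 u v = innerL2 u' v' := by
  refine integral_congr_ae ?_
  filter_upwards [e, e'] with x h1 h2
  rw [h1, h2]

theorem abs_innerL2_le {u v : ℝ → E n} (hu : MemLp u 2 volume) (hv : MemLp v 2 volume) :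
    |innerL2 u v| ≤ nrm u * nrm v := by
  rw [← inner_toLp hu hv, ← nrm_toLp hu, ← nrm_toLp hv]
  exact abs_real_inner_le_norm _ _

theorem innerL2_add_left {u u' v : ℝ → E n} (hu : MemLp u 2 volume) (hu' : MemLp u' 2 volume)
    (hv : MemLp v 2 volume) :
    innerL2 (fun x => u x + u' x) v = innerL2 u v + innerL2 u' v := by
  unfold innerL2
  rw [← integral_add (integrable_inner hu hv) (integrable_inner hu' hv)]
  simp only [inner_add_left]

theorem innerL2_sub_left {u u' v : ℝ → E n} (hu : MemLp u 2 volume) (hu' : MemLp u' 2 volume)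
    (hv : MemLp v 2 volume) :
    innerL2 (fun x => u x - u' x) v = innerL2 u v - innerL2 u' v := by
  unfold innerL2
  rw [← integral_sub (integrable_inner hu hv) (integrable_inner hu' hv)]
  simp only [inner_sub_left]

theorem innerL2_smul_left (a : ℝ) (u v : ℝ → E n) :
    innerL2 (fun x => a • u x) v = a * innerL2 u v := by
  unfold innerL2
  rw [← integral_const_mul]
  simp only [inner_smul_left, conj_trivial]

theorem innerL2_comm (u v : ℝ → E n) : innerL2 u v = innerL2 v u := by
  unfold innerL2
  simp only [real_inner_comm]

theorem memLp_locallyIntegrable {u : ℝ → E n} (hu : MemLp u 2 volume) :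
    LocallyIntegrable u volume :=
  hu.locallyIntegrable (by norm_num)

/-! ### Coercivity of the linearisation modulo its kernel -/

theorem memLp_test {φ : ℝ → ℝ} (hφ : Continuous φ) (hc : HasCompactSupport φ) (e : E n) :
    MemLp (fun x => φ x • e) 2 volume :=
  (hφ.smul continuous_const).memLp_of_hasCompactSupport hc.smul_right

/-- Weak differentiability in `L²` as a family of linear equations in `L²`, which exhibits it as a
closed condition. -/
theorem hasWeakDeriv_iff_inner (u w : L2 n) :
    HasWeakDeriv (u : ℝ → E n) w ↔ ∀ (φ : ℝ → ℝ) (hφ : ContDiff ℝ ∞ φ) (hc : HasCompactSupport φ)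
      (e : E n), inner ℝ ((memLp_test (hφ.continuous_deriv (by simp)) hc.deriv e).toLp _) u +
        inner ℝ ((memLp_test hφ.continuous hc e).toLp _) w = 0 := by
  have hu := memLp_locallyIntegrable (Lp.memLp u)
  have hw := memLp_locallyIntegrable (Lp.memLp w)
  have key : ∀ (φ : ℝ → ℝ) (hφ : Continuous φ) (hc : HasCompactSupport φ) (e : E n) (u : L2 n),
      inner ℝ ((memLp_test hφ hc e).toLp _) u = inner ℝ e (∫ x, φ x • u x) := by
    intro φ hφ hc e u
    rw [← integral_inner ((memLp_locallyIntegrable (Lp.memLp u)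
      ).integrable_smul_left_of_hasCompactSupport hφ hc) e, L2.inner_def]
    refine integral_congr_ae ?_
    filter_upwards [(memLp_test hφ hc e).coeFn_toLp] with x hx
    rw [hx, inner_smul_left, inner_smul_right]
    rfl
  constructor
  · intro h φ hφ hc e
    rw [key _ (hφ.continuous_deriv (by simp)) hc.deriv, key _ hφ.continuous hc, ← inner_add_right,
      h.integral_eq φ hφ hc, neg_add_cancel, inner_zero_right]
  · intro h
    refine ⟨hu, hw, fun φ hφ hc => ?_⟩
    rw [eq_neg_iff_add_eq_zero]
    refine ext_inner_left ℝ fun e => ?_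
    have := h φ hφ hc e
    rwa [key _ (hφ.continuous_deriv (by simp)) hc.deriv, key _ hφ.continuous hc,
      ← inner_add_right, ← inner_zero_right e] at this

theorem isClosed_hasWeakDeriv :
    IsClosed {p : L2 n × L2 n | HasWeakDeriv (p.1 : ℝ → E n) p.2} := by
  simp only [hasWeakDeriv_iff_inner, ofPred_forall]
  refine isClosed_iInter fun φ => isClosed_iInter fun hφ => isClosed_iInter fun hc =>
    isClosed_iInter fun e => isClosed_eq ?_ continuous_const
  exact (continuous_const.inner continuous_fst).add (continuous_const.inner continuous_snd)

/-- `H²` as the closed subspace of triples `(v, v', v'')` in `(L²)³`, complete for its own norm. -/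
noncomputable def jet (n : ℕ) : Submodule ℝ (L2 n × L2 n × L2 n) where
  carrier := {p | HasWeakDeriv (p.1 : ℝ → E n) p.2.1 ∧ HasWeakDeriv (p.2.1 : ℝ → E n) p.2.2}
  add_mem' hp hq :=
    ⟨((hp.1.add hq.1).congr (Lp.coeFn_add _ _).symm).congr_deriv (Lp.coeFn_add _ _).symm,
      ((hp.2.add hq.2).congr (Lp.coeFn_add _ _).symm).congr_deriv (Lp.coeFn_add _ _).symm⟩
  zero_mem' :=
    ⟨(HasWeakDeriv.zero.congr (Lp.coeFn_zero _ _ _).symm).congr_deriv (Lp.coeFn_zero _ _ _).symm,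
      (HasWeakDeriv.zero.congr (Lp.coeFn_zero _ _ _).symm).congr_deriv (Lp.coeFn_zero _ _ _).symm⟩
  smul_mem' a _ hp :=
    ⟨((hp.1.smul a).congr (Lp.coeFn_smul _ _).symm).congr_deriv (Lp.coeFn_smul _ _).symm,
      ((hp.2.smul a).congr (Lp.coeFn_smul _ _).symm).congr_deriv (Lp.coeFn_smul _ _).symm⟩

theorem isClosed_jet : IsClosed (jet n : Set (L2 n × L2 n × L2 n)) :=
  (isClosed_hasWeakDeriv.preimage
    (continuous_fst.prodMk (continuous_fst.comp continuous_snd))).inter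
    (isClosed_hasWeakDeriv.preimage continuous_snd)

noncomputable instance : CompleteSpace (jet n) := isClosed_jet.completeSpace_coe

/-- The identification of the space of jets with `H²`. -/
noncomputable def jetToH2 (n : ℕ) : jet n →ₗ[ℝ] H2 n where
  toFun p := ⟨p.1.1, Lp.memLp _, _, p.2.1, Lp.memLp _, _, p.2.2, Lp.memLp _⟩
  map_add' _ _ := rfl
  map_smul' _ _ := rfl

theorem jetToH2_injective : Function.Injective (jetToH2 n) := by
  rintro ⟨⟨v, w, z⟩, h1, h2⟩ ⟨⟨v', w', z'⟩, h1', h2'⟩ h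
  have e : v = v' := congrArg Subtype.val h
  subst e
  have e : w = w' := Lp.ext (h1.unique h1')
  subst e
  have e : z = z' := Lp.ext (h2.unique h2')
  subst e
  rfl

theorem jetToH2_surjective : Function.Surjective (jetToH2 n) := by
  rintro ⟨v, h0, w, hw, h1, z, hz, h2⟩
  exact ⟨⟨(v, h1.toLp w, h2.toLp z), hw.congr_deriv h1.coeFn_toLp.symm,
    (hz.congr h1.coeFn_toLp.symm).congr_deriv h2.coeFn_toLp.symm⟩, rfl⟩

/-- `L` may be computed from any choice of weak derivatives. -/
theorem ActsAs.ae_eq {L : H2 n →ₗ[ℝ] L2 n} {ρ c : ℝ} {B : ℝ → E n →L[ℝ] E n}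
    (hL : ActsAs L ρ c B) (v : H2 n) {w z : ℝ → E n} (h1 : HasWeakDeriv (v : L2 n) w)
    (h2 : HasWeakDeriv w z) :
    ∀ᵐ ξ, L v ξ = c • w ξ + ρ • z ξ + B ξ ((v : L2 n) ξ) := by
  have e1 := h1.weakDeriv_ae
  filter_upwards [hL v, e1, (h2.congr e1.symm).weakDeriv_ae] with ξ a b c
  rw [a, b, c]

/-- The formal adjoint is the adjoint, by integration by parts. -/
theorem ActsAs.inner_adjoint {L Ladj : H2 n →ₗ[ℝ] L2 n} {ρ c : ℝ} {B : ℝ → E n →L[ℝ] E n}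
    (hL : ActsAs L ρ c B)
    (hadj : ActsAs Ladj ρ (-c) (fun ξ => ContinuousLinearMap.adjoint (B ξ))) (v u : H2 n) :
    inner ℝ (L v) (u : L2 n) = inner ℝ (v : L2 n) (Ladj u) := by
  obtain ⟨v, hv⟩ := v
  obtain ⟨u, hu⟩ := u
  have hv' := hv
  have hu' := hu
  obtain ⟨mv, w, hw, mw, z, hz, mz⟩ := hv'
  obtain ⟨mu, y, hy, my, x, hx, mx⟩ := hu'
  have a1 := hL.ae_eq ⟨v, hv⟩ hw hz
  have a2 := hadj.ae_eq ⟨u, hu⟩ hy hx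
  set F := L ⟨v, hv⟩
  set F' := Ladj ⟨u, hu⟩
  have mF := Lp.memLp F
  have mF' := Lp.memLp F'
  have mcz : MemLp (fun ξ => c • w ξ + ρ • z ξ) 2 volume := (mw.const_smul c).add (mz.const_smul ρ)
  have mcx : MemLp (fun ξ => (-c) • y ξ + ρ • x ξ) 2 volume :=
    (my.const_smul (-c)).add (mx.const_smul ρ)
  have e1 : innerL2 (fun ξ => F ξ - (c • w ξ + ρ • z ξ)) u =
      innerL2 (fun ξ => F' ξ - ((-c) • y ξ + ρ • x ξ)) v := by
    refine integral_congr_ae ?_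
    filter_upwards [a1, a2] with ξ h1 h2
    rw [h1, h2, add_sub_cancel_left, add_sub_cancel_left, ContinuousLinearMap.adjoint_inner_left,
      real_inner_comm]
  rw [innerL2_sub_left mF mcz mu, innerL2_sub_left mF' mcx mv,
    innerL2_add_left (memLp_smul c mw) (memLp_smul ρ mz) mu,
    innerL2_add_left (memLp_smul (-c) my) (memLp_smul ρ mx) mv, innerL2_smul_left,
    innerL2_smul_left, innerL2_smul_left, innerL2_smul_left,
    hw.innerL2_eq_neg hy mv mw mu my, hz.innerL2_eq_neg hy mw mz mu my,
    hw.innerL2_eq_neg hx mv mw my mx, innerL2_comm y v, innerL2_comm x v] at e1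
  have e2 : innerL2 F u = innerL2 F' v := by linarith
  rw [L2.inner_def, L2.inner_def]
  change innerL2 F u = innerL2 v F'
  rw [e2, innerL2_comm]

/-- By the Fredholm alternative the range of `L` is the orthogonal complement of the
kernel of the adjoint. -/
theorem mem_range_of_inner_eq_zero {L Ladj : H2 n →ₗ[ℝ] L2 n} {ρ c : ℝ} {B : ℝ → E n →L[ℝ] E n}
    (hL : ActsAs L ρ c B)
    (hadj : ActsAs Ladj ρ (-c) (fun ξ => ContinuousLinearMap.adjoint (B ξ)))
    (fred : IsFredholmIndexZero L) {φ ψ : H2 n} (kL : LinearMap.ker L = Submodule.span ℝ {φ})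
    (hψ : Ladj ψ = 0) (h1 : inner ℝ (φ : L2 n) (ψ : L2 n) = 1) (y : L2 n)
    (hy : inner ℝ y (ψ : L2 n) = 0) : y ∈ LinearMap.range L := by
  obtain ⟨-, f2, f3⟩ := fred
  have hφ : φ ≠ 0 := by
    rintro rfl
    simp at h1
  rw [kL, finrank_span_singleton hφ] at f3
  -- `⟨·, ψ⟩` vanishes on the range, so it factors through the one-dimensional cokernel
  let l : L2 n →ₗ[ℝ] ℝ := (innerSL ℝ (ψ : L2 n) : L2 n →L[ℝ] ℝ)
  have hl : LinearMap.range L ≤ LinearMap.ker l := by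
    rintro _ ⟨v, rfl⟩
    rw [LinearMap.mem_ker]
    change inner ℝ (ψ : L2 n) (L v) = 0
    rw [real_inner_comm, hL.inner_adjoint hadj, hψ, inner_zero_right]
  let q := (LinearMap.range L).liftQ l hl
  have hq : Function.Surjective q := by
    intro t
    refine ⟨Submodule.Quotient.mk (t • (φ : L2 n)), ?_⟩
    change inner ℝ (ψ : L2 n) (t • (φ : L2 n)) = t
    rw [inner_smul_right, real_inner_comm, h1, mul_one]
  have hinj : Function.Injective q :=
    (LinearMap.injective_iff_surjective_of_finrank_eq_finrank (by simp [← f3])).2 hq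
  have : Submodule.Quotient.mk (p := LinearMap.range L) y = 0 := by
    apply hinj
    rw [map_zero]
    change inner ℝ (ψ : L2 n) y = 0
    rw [real_inner_comm, hy]
  exact (Submodule.Quotient.mk_eq_zero _).1 this

/-- On the complement `⟨v, ψ⟩ = 0` of the kernel, the `H²` norm of `v` and the size of `a` are
controlled by the `L²` norm of `L v + a φ`: the map `(v, a) ↦ (L v + a φ, ⟨v, ψ⟩)` is a continuous
bijection of Banach spaces. -/
theorem exists_coercive {L Ladj : H2 n →ₗ[ℝ] L2 n} {ρ c M : ℝ} {B : ℝ → E n →L[ℝ] E n}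
    {φ ψ : ℝ → E n} (hL : ActsAs L ρ c B)
    (hadj : ActsAs Ladj ρ (-c) (fun ξ => ContinuousLinearMap.adjoint (B ξ)))
    (hM : ∀ ξ, ‖B ξ‖ ≤ M) (fred : IsFredholmIndexZero L) (kL : KerEqSpan L φ)
    (kadj : KerEqSpan Ladj ψ) (h1 : innerL2 φ ψ = 1) :
    ∃ C : ℝ, 0 < C ∧ ∀ v w z : ℝ → E n, HasWeakDeriv v w → HasWeakDeriv w z →
      MemLp v 2 volume → MemLp w 2 volume → MemLp z 2 volume → innerL2 v ψ = 0 → ∀ a : ℝ,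
      nrm v + nrm w + nrm z + |a| ≤
        C * nrm (fun ξ => c • w ξ + ρ • z ξ + B ξ (v ξ) + a • φ ξ) := by
  obtain ⟨φ', eφ, kL⟩ := kL
  obtain ⟨ψ', eψ, kadj⟩ := kadj
  have Lφ : L φ' = 0 := by
    rw [← LinearMap.mem_ker, kL]; exact Submodule.mem_span_singleton_self _
  have Lψ : Ladj ψ' = 0 := by
    rw [← LinearMap.mem_ker, kadj]; exact Submodule.mem_span_singleton_self _
  have h1' : inner ℝ (φ' : L2 n) (ψ' : L2 n) = 1 := by
    rw [← h1, L2.inner_def]; exact innerL2_congr eφ eψ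
  have hM0 : 0 ≤ M := (norm_nonneg _).trans (hM 0)
  have hp : ∀ p : jet n, ‖(p : L2 n × L2 n × L2 n).1‖ ≤ ‖p‖ ∧
      ‖(p : L2 n × L2 n × L2 n).2.1‖ ≤ ‖p‖ ∧ ‖(p : L2 n × L2 n × L2 n).2.2‖ ≤ ‖p‖ := fun p =>
    ⟨norm_fst_le _, (norm_fst_le _).trans (norm_snd_le _), (norm_snd_le _).trans (norm_snd_le _)⟩
  have hbound : ∀ p : jet n, ‖(L ∘ₗ jetToH2 n) p‖ ≤ (M + |c| + |ρ|) * ‖p‖ := by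
    intro p
    obtain ⟨b1, b2, b3⟩ := hp p
    obtain ⟨⟨v, w, z⟩, h1, h2⟩ := p
    have a := hL.ae_eq (jetToH2 n ⟨(v, w, z), h1, h2⟩) h1 h2
    rw [LinearMap.comp_apply]
    set y := L (jetToH2 n ⟨(v, w, z), h1, h2⟩)
    set P := ‖(⟨(v, w, z), h1, h2⟩ : jet n)‖
    have e : ‖y - (c • w + ρ • z)‖ ≤ M * ‖v‖ := by
      refine Lp.norm_le_mul_norm_of_ae_le_mul ?_
      filter_upwards [a, Lp.coeFn_sub y (c • w + ρ • z), Lp.coeFn_add (c • w) (ρ • z),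
        Lp.coeFn_smul c w, Lp.coeFn_smul ρ z] with ξ h1 h2 h3 h4 h5
      rw [h2, Pi.sub_apply, h3, Pi.add_apply, h4, h5, h1, Pi.smul_apply, Pi.smul_apply,
        add_sub_cancel_left]
      exact ((B ξ).le_opNorm _).trans (mul_le_mul_of_nonneg_right (hM ξ) (norm_nonneg _))
    have e2 : ‖y‖ ≤ ‖y - (c • w + ρ • z)‖ + (‖c • w‖ + ‖ρ • z‖) :=
      (norm_le_norm_sub_add y (c • w + ρ • z)).trans
        (add_le_add le_rfl (norm_add_le _ _))
    rw [norm_smul, norm_smul, Real.norm_eq_abs, Real.norm_eq_abs] at e2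
    have t1 := mul_le_mul_of_nonneg_left b1 hM0
    have t2 := mul_le_mul_of_nonneg_left b2 (abs_nonneg c)
    have t3 := mul_le_mul_of_nonneg_left b3 (abs_nonneg ρ)
    simp only at t1 t2 t3
    calc _ ≤ M * ‖v‖ + (|c| * ‖w‖ + |ρ| * ‖z‖) := by linarith
      _ ≤ _ := by linarith
  let A : jet n →L[ℝ] L2 n := (L ∘ₗ jetToH2 n).mkContinuous _ hbound
  let π : jet n →L[ℝ] L2 n := (ContinuousLinearMap.fst ℝ _ _).comp (jet n).subtypeL
  let T : (jet n × ℝ) →L[ℝ] (L2 n × ℝ) :=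
    (A.coprod ((ContinuousLinearMap.id ℝ ℝ).smulRight (φ' : L2 n))).prod
      (((innerSL ℝ (ψ' : L2 n)).comp π).comp (ContinuousLinearMap.fst ℝ _ _))
  have hT : ∀ p a, T (p, a) = (L (jetToH2 n p) + a • (φ' : L2 n),
      inner ℝ (ψ' : L2 n) (p : L2 n × L2 n × L2 n).1) := fun p a => rfl
  have hinj : LinearMap.ker (T : (jet n × ℝ) →ₗ[ℝ] (L2 n × ℝ)) = ⊥ := by
    rw [LinearMap.ker_eq_bot']
    rintro ⟨p, a⟩ h
    change T (p, a) = 0 at h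
    rw [hT, Prod.mk_eq_zero] at h
    obtain ⟨e1, e2⟩ := h
    have e3 : a = 0 := by
      have := congrArg (fun y => inner ℝ y (ψ' : L2 n)) e1
      simp only [inner_add_left, inner_smul_left, h1', hL.inner_adjoint hadj, Lψ] at this
      simpa using this
    rw [e3, zero_smul, add_zero, ← LinearMap.mem_ker, kL, Submodule.mem_span_singleton] at e1
    obtain ⟨t, ht⟩ := e1
    have e4 : t = 0 := by
      have : ((jetToH2 n p : H2 n) : L2 n) = t • (φ' : L2 n) := by rw [← ht]; rfl
      change inner ℝ (ψ' : L2 n) ((jetToH2 n p : H2 n) : L2 n) = 0 at e2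
      rw [this, inner_smul_right, real_inner_comm, h1', mul_one] at e2
      exact e2
    rw [e4, zero_smul] at ht
    have : p = 0 := jetToH2_injective (by rw [← ht, map_zero])
    rw [this, e3]
    rfl
  have hsurj : LinearMap.range (T : (jet n × ℝ) →ₗ[ℝ] (L2 n × ℝ)) = ⊤ := by
    rw [LinearMap.range_eq_top]
    rintro ⟨y, t⟩
    set a := inner ℝ y (ψ' : L2 n) with ha
    obtain ⟨v, hv⟩ := mem_range_of_inner_eq_zero hL hadj fred kL Lψ h1' (y - a • (φ' : L2 n))
      (by rw [inner_sub_left, inner_smul_left, h1']; simp [ha])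
    obtain ⟨p, hp⟩ := jetToH2_surjective (v + (t - inner ℝ (ψ' : L2 n) (v : L2 n)) • φ')
    refine ⟨(p, a), ?_⟩
    change T (p, a) = _
    rw [hT, hp]
    refine Prod.ext ?_ ?_
    · simp [hv, Lφ]
    · change inner ℝ (ψ' : L2 n) ((jetToH2 n p : H2 n) : L2 n) = t
      rw [hp]
      simp [inner_add_right, inner_smul_right, real_inner_comm, h1']
  let e := ContinuousLinearEquiv.ofBijective T hinj hsurj
  refine ⟨4 * (‖(e.symm : (L2 n × ℝ) →L[ℝ] (jet n × ℝ))‖ + 1), by positivity, ?_⟩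
  intro v w z hw hz mv mw mz hv a
  set V := mv.toLp v with hV
  set W := mw.toLp w with hW
  set Z := mz.toLp z with hZ
  have g1 : HasWeakDeriv (V : ℝ → E n) W :=
    (hw.congr mv.coeFn_toLp.symm).congr_deriv mw.coeFn_toLp.symm
  have g2 : HasWeakDeriv (W : ℝ → E n) Z :=
    (hz.congr mw.coeFn_toLp.symm).congr_deriv mz.coeFn_toLp.symm
  let p : jet n := ⟨(V, W, Z), g1, g2⟩
  have hin : inner ℝ (ψ' : L2 n) V = 0 := by
    rw [real_inner_comm, L2.inner_def, ← hv]
    exact innerL2_congr mv.coeFn_toLp eψ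
  have hle : ‖(p, a)‖ ≤ ‖(e.symm : (L2 n × ℝ) →L[ℝ] (jet n × ℝ))‖ *
      ‖L (jetToH2 n p) + a • (φ' : L2 n)‖ := by
    have q1 : e.symm (T (p, a)) = (p, a) := e.symm_apply_apply _
    have q2 := (e.symm : (L2 n × ℝ) →L[ℝ] (jet n × ℝ)).le_opNorm (T (p, a))
    rw [ContinuousLinearEquiv.coe_coe, q1, hT] at q2
    refine q2.trans (le_of_eq ?_)
    congr 1
    change max ‖L (jetToH2 n p) + a • (φ' : L2 n)‖ ‖(inner ℝ (ψ' : L2 n) V : ℝ)‖ = _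
    rw [hin, norm_zero, max_eq_left (norm_nonneg _)]
  have hN : ‖L (jetToH2 n p) + a • (φ' : L2 n)‖ =
      nrm (fun ξ => c • w ξ + ρ • z ξ + B ξ (v ξ) + a • φ ξ) := by
    refine (Lp.norm_def _).trans (nrm_congr ?_)
    filter_upwards [hL.ae_eq (jetToH2 n p) g1 g2, Lp.coeFn_add (L (jetToH2 n p)) (a • (φ' : L2 n)),
      Lp.coeFn_smul a (φ' : L2 n), eφ, mv.coeFn_toLp, mw.coeFn_toLp, mz.coeFn_toLp]
      with ξ q1 q2 q3 q4 q5 q6 q7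
    rw [q2, Pi.add_apply, q3, Pi.smul_apply, q4, q1, q6, q7]
    change _ + B ξ (V ξ) + _ = _
    rw [q5]
  obtain ⟨b1, b2, b3⟩ := hp p
  have b4 : ‖p‖ ≤ ‖(p, a)‖ := norm_fst_le (p, a)
  have b5 : |a| ≤ ‖(p, a)‖ := norm_snd_le (p, a)
  rw [hN] at hle
  rw [← nrm_toLp mv, ← nrm_toLp mw, ← nrm_toLp mz]
  have b6 := nrm_nonneg (fun ξ => c • w ξ + ρ • z ξ + B ξ (v ξ) + a • φ ξ)
  change ‖V‖ ≤ _ at b1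
  change ‖W‖ ≤ _ at b2
  change ‖Z‖ ≤ _ at b3
  nlinarith

end

/-! ### Exponential decay of the wave profile -/

section

variable {n : ℕ}

/-- The weight `exp(-ν |ξ|)`. -/
noncomputable def weight (ν ξ : ℝ) : ℝ := Real.exp (-ν * |ξ|)

theorem weight_pos (ν ξ : ℝ) : 0 < weight ν ξ := Real.exp_pos _

theorem weight_le_one {ν : ℝ} (hν : 0 ≤ ν) (ξ : ℝ) : weight ν ξ ≤ 1 :=
  Real.exp_le_one_iff.2 (by nlinarith [abs_nonneg ξ])

theorem weight_anti {ν ν' : ℝ} (h : ν ≤ ν') (ξ : ℝ) : weight ν' ξ ≤ weight ν ξ :=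
  Real.exp_le_exp.2 (by nlinarith [abs_nonneg ξ])

theorem memLp_weight {ν : ℝ} (hν : 0 < ν) : MemLp (weight ν) 2 volume := by
  have hc : Continuous (weight ν) := by unfold weight; fun_prop
  rw [memLp_two_iff_integrable_sq hc.aestronglyMeasurable]
  rw [← integrableOn_univ, ← Iic_union_Ioi (a := (0 : ℝ))]
  refine IntegrableOn.union ?_ ?_
  · refine (integrableOn_exp_mul_Iic (a := 2 * ν) (by linarith) 0).congr_fun (fun x hx => ?_)
      measurableSet_Iic
    simp only [weight]
    rw [abs_of_nonpos hx, ← Real.exp_nat_mul]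
    push_cast; ring_nf
  · refine (integrableOn_exp_mul_Ioi (a := -(2 * ν)) (by linarith) 0).congr_fun (fun x hx => ?_)
      measurableSet_Ioi
    simp only [weight]
    rw [abs_of_pos hx, ← Real.exp_nat_mul]
    push_cast; ring_nf

theorem memLp_of_weight {ν C : ℝ} (hν : 0 < ν) {u : ℝ → E n} (hu : Continuous u)
    (hb : ∀ ξ, ‖u ξ‖ ≤ C * weight ν ξ) : MemLp u 2 volume :=
  ((memLp_weight hν).const_mul C).mono' hu.aestronglyMeasurable (Eventually.of_forall hb)

theorem exists_lipschitz_on_ball {F G : Type*} [NormedAddCommGroup F] [NormedSpace ℝ F]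
    [ProperSpace F] [NormedAddCommGroup G] [NormedSpace ℝ G] {h : F → G} (hh : ContDiff ℝ 1 h)
    (R : ℝ) : ∃ C : ℝ, 0 < C ∧ ∀ x y, ‖x‖ ≤ R → ‖y‖ ≤ R → ‖h x - h y‖ ≤ C * ‖x - y‖ := by
  obtain ⟨K, hK⟩ := (hh.locallyLipschitz.locallyLipschitzOn
    (s := Metric.closedBall (0 : F) R)).exists_lipschitzOnWith_of_compact
    (isCompact_closedBall _ _)
  refine ⟨K + 1, by positivity, fun x y hx hy => ?_⟩
  have := hK.dist_le_mul x (by simpa using hx) y (by simpa using hy)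
  rw [dist_eq_norm, dist_eq_norm] at this
  nlinarith [norm_nonneg (x - y)]

/-- `φ₁, φ₂, φ₃` are the derivatives of the wave profile `Φ₀`, which solves the profile equation
and is bounded with exponentially decaying derivatives. The rate `ν` is common to both ends of the
line. -/
structure Profile (ρ : ℝ) (f : E n → E n) (Φ₀ : ℝ → E n) (c₀ : ℝ) (φ₁ φ₂ φ₃ : ℝ → E n)
    (C ν : ℝ) : Prop where
  posC : 0 < C
  posν : 0 < ν
  d0 : ∀ ξ, HasDerivAt Φ₀ (φ₁ ξ) ξ
  d1 : ∀ ξ, HasDerivAt φ₁ (φ₂ ξ) ξ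
  d2 : ∀ ξ, HasDerivAt φ₂ (φ₃ ξ) ξ
  ode : ∀ ξ, ρ • φ₂ ξ + c₀ • φ₁ ξ + f (Φ₀ ξ) = 0
  bound0 : ∀ ξ, ‖Φ₀ ξ‖ ≤ C
  bound1 : ∀ ξ, ‖φ₁ ξ‖ ≤ C * weight ν ξ
  bound2 : ∀ ξ, ‖φ₂ ξ‖ ≤ C * weight ν ξ
  bound3 : ∀ ξ, ‖φ₃ ξ‖ ≤ C * weight ν ξ

theorem HTw.ode {ρ : ℝ} {f : E n → E n} {um up : E n} {Φ₀ : ℝ → E n} {c₀ : ℝ}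
    (h : HTw ρ f um up Φ₀ c₀) (ξ : ℝ) :
    ρ • deriv (deriv Φ₀) ξ + c₀ • deriv Φ₀ ξ + f (Φ₀ ξ) = 0 := by
  have hd : HasDerivAt Φ₀ (deriv Φ₀ ξ) ξ :=
    (h.contDiff.differentiable (by norm_num) ξ).hasDerivAt
  have h1 : HasDerivAt (fun s : ℝ => ξ - c₀ * s) (-c₀) 0 := by
    simpa using ((hasDerivAt_id (0 : ℝ)).const_mul c₀).const_sub ξ
  have h2 : HasDerivAt (fun s : ℝ => Φ₀ (ξ - c₀ * s)) ((-c₀) • deriv Φ₀ ξ) 0 :=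
    HasDerivAt.scomp (h := fun s : ℝ => ξ - c₀ * s) 0 (by simpa using hd) h1
  have := h.pde ξ 0
  rw [h2.deriv] at this
  simp only [mul_zero, sub_zero, iteratedDeriv_succ, iteratedDeriv_zero] at this
  rw [neg_smul] at this
  rw [add_right_comm, ← this, neg_add_cancel]

/-- The profile equation passes the decay of `Φ₀ - u_±` and `Φ₀'` on to `Φ₀''` and,
once differentiated, to `Φ₀'''`. -/
theorem HTw.exists_profile {ρ : ℝ} (hρ : 0 < ρ) {f : E n → E n} {um up : E n} {Φ₀ : ℝ → E n}
    {c₀ : ℝ} (hf : Hf f um up) (h : HTw ρ f um up Φ₀ c₀) :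
    ∃ φ₃ C ν, Profile ρ f Φ₀ c₀ (deriv Φ₀) (deriv (deriv Φ₀)) φ₃ C ν := by
  obtain ⟨K, νm, νp, hK, hνm, hνp, hm, hp⟩ := h.decay
  set ν := min νm νp with hν
  have posν : 0 < ν := lt_min hνm hνp
  set φ₁ := deriv Φ₀ with hφ₁
  set φ₂ := deriv φ₁ with hφ₂
  have d0 : ∀ ξ, HasDerivAt Φ₀ (φ₁ ξ) ξ := fun ξ =>
    (h.contDiff.differentiable (by norm_num) ξ).hasDerivAt
  have d1 : ∀ ξ, HasDerivAt φ₁ (φ₂ ξ) ξ := fun ξ => by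
    have : ContDiff ℝ 1 φ₁ := ((contDiff_succ_iff_deriv (n := 1)).1
      (by rw [one_add_one_eq_two]; exact h.contDiff)).2.2
    exact (this.differentiable (by norm_num) ξ).hasDerivAt
  have eφ₂ : φ₂ = fun ξ => ρ⁻¹ • -(c₀ • φ₁ ξ + f (Φ₀ ξ)) := by
    funext ξ
    have := h.ode ξ
    rw [add_assoc] at this
    rw [← eq_neg_of_add_eq_zero_left this, smul_smul, inv_mul_cancel₀ hρ.ne', one_smul]
  have df : Differentiable ℝ f := hf.contDiff.differentiable (by norm_num)
  have dfΦ : ∀ ξ, HasDerivAt (fun ξ => f (Φ₀ ξ)) (fderiv ℝ f (Φ₀ ξ) (φ₁ ξ)) ξ := fun ξ =>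
    (df (Φ₀ ξ)).hasFDerivAt.comp_hasDerivAt ξ (d0 ξ)
  have d2 : ∀ ξ, HasDerivAt φ₂ (ρ⁻¹ • -(c₀ • φ₂ ξ + fderiv ℝ f (Φ₀ ξ) (φ₁ ξ))) ξ := fun ξ => by
    have := ((((d1 ξ).const_smul c₀).add (dfΦ ξ)).neg).const_smul ρ⁻¹
    refine this.congr_of_eventuallyEq (Eventually.of_forall fun x => ?_)
    rw [eφ₂]; rfl
  have wm : ∀ ξ, weight νm ξ ≤ weight ν ξ := fun ξ => weight_anti (min_le_left _ _) ξ
  have wp : ∀ ξ, weight νp ξ ≤ weight ν ξ := fun ξ => weight_anti (min_le_right _ _) ξ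
  have b1 : ∀ ξ, ‖φ₁ ξ‖ ≤ K * weight ν ξ := fun ξ => by
    rcases le_total ξ 0 with hξ | hξ
    · have := hm ξ hξ
      have w := mul_le_mul_of_nonneg_left (wm ξ) hK.le
      unfold weight at w ⊢
      linarith [norm_nonneg (Φ₀ ξ - um)]
    · have := hp ξ hξ
      have w := mul_le_mul_of_nonneg_left (wp ξ) hK.le
      unfold weight at w ⊢
      linarith [norm_nonneg (Φ₀ ξ - up)]
  set R := K + ‖um‖ + ‖up‖ with hR
  have b0 : ∀ ξ, ‖Φ₀ ξ‖ ≤ R := fun ξ => by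
    have t1 := norm_le_norm_sub_add (Φ₀ ξ) um
    have t2 := norm_le_norm_sub_add (Φ₀ ξ) up
    rcases le_total ξ 0 with hξ | hξ
    · have := hm ξ hξ
      have w := mul_le_mul_of_nonneg_left (weight_le_one hνm.le ξ) hK.le
      unfold weight at w
      linarith [norm_nonneg (φ₁ ξ), norm_nonneg up]
    · have := hp ξ hξ
      have w := mul_le_mul_of_nonneg_left (weight_le_one hνp.le ξ) hK.le
      unfold weight at w
      linarith [norm_nonneg (φ₁ ξ), norm_nonneg um]
  obtain ⟨Lf, hLf, lip⟩ := exists_lipschitz_on_ball (hf.contDiff.of_le (by norm_num)) R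
  obtain ⟨M, hM⟩ : ∃ M, ∀ x ∈ Metric.closedBall (0 : E n) R, ‖fderiv ℝ f x‖ ≤ M :=
    (isCompact_closedBall _ _).exists_bound_of_continuousOn
      (hf.contDiff.continuous_fderiv (by norm_num)).continuousOn
  have hM' : ∀ ξ, ‖fderiv ℝ f (Φ₀ ξ)‖ ≤ |M| := fun ξ =>
    (hM _ (by simpa using b0 ξ)).trans (le_abs_self M)
  have bf : ∀ ξ, ‖f (Φ₀ ξ)‖ ≤ Lf * K * weight ν ξ := fun ξ => by
    rcases le_total ξ 0 with hξ | hξ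
    · have := hm ξ hξ
      have w := mul_le_mul_of_nonneg_left (wm ξ) hK.le
      have l := lip (Φ₀ ξ) um (b0 ξ) (by linarith [norm_nonneg up])
      rw [hf.zero_minus, sub_zero] at l
      unfold weight at w ⊢
      rw [mul_assoc]
      exact l.trans (mul_le_mul_of_nonneg_left (by linarith [norm_nonneg (φ₁ ξ)]) hLf.le)
    · have := hp ξ hξ
      have w := mul_le_mul_of_nonneg_left (wp ξ) hK.le
      have l := lip (Φ₀ ξ) up (b0 ξ) (by linarith [norm_nonneg um])
      rw [hf.zero_plus, sub_zero] at l
      unfold weight at w ⊢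
      rw [mul_assoc]
      exact l.trans (mul_le_mul_of_nonneg_left (by linarith [norm_nonneg (φ₁ ξ)]) hLf.le)
  set C2 := ρ⁻¹ * (|c₀| * K + Lf * K) with hC2
  have b2 : ∀ ξ, ‖φ₂ ξ‖ ≤ C2 * weight ν ξ := fun ξ => by
    rw [eφ₂]
    simp only [norm_smul, norm_neg, norm_inv, Real.norm_eq_abs, abs_of_pos hρ]
    rw [hC2, mul_assoc]
    refine mul_le_mul_of_nonneg_left ?_ (inv_nonneg.2 hρ.le)
    refine (norm_add_le _ _).trans ?_
    rw [norm_smul, Real.norm_eq_abs]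
    nlinarith [bf ξ, mul_le_mul_of_nonneg_left (b1 ξ) (abs_nonneg c₀)]
  set C3 := ρ⁻¹ * (|c₀| * C2 + |M| * K) with hC3
  have b3 : ∀ ξ, ‖ρ⁻¹ • -(c₀ • φ₂ ξ + fderiv ℝ f (Φ₀ ξ) (φ₁ ξ))‖ ≤ C3 * weight ν ξ := fun ξ => by
    simp only [norm_smul, norm_neg, norm_inv, Real.norm_eq_abs, abs_of_pos hρ]
    rw [hC3, mul_assoc]
    refine mul_le_mul_of_nonneg_left ?_ (inv_nonneg.2 hρ.le)
    refine (norm_add_le _ _).trans ?_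
    rw [norm_smul, Real.norm_eq_abs]
    have t1 := (fderiv ℝ f (Φ₀ ξ)).le_opNorm (φ₁ ξ)
    have t2 := mul_le_mul (hM' ξ) (b1 ξ) (norm_nonneg _) (abs_nonneg M)
    nlinarith [mul_le_mul_of_nonneg_left (b2 ξ) (abs_nonneg c₀)]
  have pC2 : 0 ≤ C2 := by positivity
  have pC3 : 0 ≤ C3 := by positivity
  refine ⟨_, R + C2 + C3, ν, by positivity, posν, d0, d1, d2, h.ode, fun ξ => ?_, fun ξ => ?_,
    fun ξ => ?_, fun ξ => ?_⟩
  · linarith [b0 ξ]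
  · refine (b1 ξ).trans (mul_le_mul_of_nonneg_right ?_ (weight_pos _ _).le)
    linarith [norm_nonneg um, norm_nonneg up]
  · refine (b2 ξ).trans (mul_le_mul_of_nonneg_right ?_ (weight_pos _ _).le)
    linarith [norm_nonneg um, norm_nonneg up]
  · refine (b3 ξ).trans (mul_le_mul_of_nonneg_right ?_ (weight_pos _ _).le)
    linarith [norm_nonneg um, norm_nonneg up]

/-- Dilations and translations change a function with exponentially decaying derivative by a small
amount, uniformly in a slightly weaker exponential weight. -/
theorem norm_dilate_sub_le {F F' : ℝ → E n} {C ν α γ : ℝ} (hC : 0 ≤ C) (hν : 0 < ν)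
    (hF : ∀ ξ, HasDerivAt F (F' ξ) ξ) (hF' : ∀ ξ, ‖F' ξ‖ ≤ C * weight ν ξ) (hα : 1 ≤ α)
    (hα' : α ≤ 2) (hγ : |γ| ≤ 1) (ξ : ℝ) :
    ‖F (α * (ξ - γ)) - F ξ‖ ≤
      C * (Real.exp ν * (2 + 2 / ν)) * ((α - 1) + |γ|) * weight (ν / 2) ξ := by
  obtain ⟨g1, g2⟩ := abs_le.1 hγ
  -- every point between `ξ` and `α (ξ - γ)` has modulus at least `|ξ| - 1`
  have hy : ∀ y ∈ uIcc ξ (α * (ξ - γ)), ‖F' y‖ ≤ C * (Real.exp ν * weight ν ξ) := by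
    intro y hy
    refine (hF' y).trans (mul_le_mul_of_nonneg_left ?_ hC)
    unfold weight
    rw [← Real.exp_add, Real.exp_le_exp]
    have : |ξ| - 1 ≤ |y| := by
      rw [mem_uIcc] at hy
      rcases le_total 0 ξ with h0 | h0
      · rw [abs_of_nonneg h0]
        have : ξ - 1 ≤ y ∨ ξ ≤ γ := by
          rcases le_total ξ γ with h | h
          · exact Or.inr h
          · left
            have : ξ - γ ≤ α * (ξ - γ) := by nlinarith
            rcases hy with hy | hy <;> linarith [hy.1]
        rcases this with h | h
        · exact h.trans (le_abs_self y)
        · linarith [abs_nonneg y]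
      · rw [abs_of_nonpos h0]
        have : y ≤ ξ + 1 ∨ γ ≤ ξ := by
          rcases le_total γ ξ with h | h
          · exact Or.inr h
          · left
            have : α * (ξ - γ) ≤ ξ - γ := by nlinarith
            rcases hy with hy | hy <;> linarith [hy.2]
        rcases this with h | h
        · linarith [neg_abs_le y]
        · linarith [abs_nonneg y]
    nlinarith
  have mv := (convex_uIcc ξ (α * (ξ - γ))).norm_image_sub_le_of_norm_hasDerivWithin_le
    (fun y _ => (hF y).hasDerivWithinAt) hy left_mem_uIcc right_mem_uIcc
  refine mv.trans ?_
  have hdist : ‖α * (ξ - γ) - ξ‖ ≤ ((α - 1) + |γ|) * (2 + |ξ|) := by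
    rw [Real.norm_eq_abs, show α * (ξ - γ) - ξ = (α - 1) * ξ - α * γ by ring]
    refine (abs_sub _ _).trans ?_
    rw [abs_mul, abs_mul, abs_of_nonneg (by linarith : 0 ≤ α - 1),
      abs_of_nonneg (by linarith : 0 ≤ α)]
    have x1 := mul_nonneg (abs_nonneg γ) (abs_nonneg ξ)
    have x2 := mul_le_mul_of_nonneg_right hα' (abs_nonneg γ)
    have x3 : ((α - 1) + |γ|) * (2 + |ξ|) =
        (α - 1) * |ξ| + 2 * |γ| + 2 * (α - 1) + |γ| * |ξ| := by ring
    linarith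
  have hw : (2 + |ξ|) * weight ν ξ ≤ (2 + 2 / ν) * weight (ν / 2) ξ := by
    have e : weight ν ξ = weight (ν / 2) ξ * weight (ν / 2) ξ := by
      unfold weight; rw [← Real.exp_add]; ring_nf
    have h1 := weight_le_one (half_pos hν).le ξ
    have h0 := weight_pos (ν / 2) ξ
    have h2 : |ξ| * weight (ν / 2) ξ ≤ 2 / ν := by
      have := Real.add_one_le_exp (ν / 2 * |ξ|)
      have h3 : Real.exp (ν / 2 * |ξ|) * weight (ν / 2) ξ = 1 := by
        unfold weight; rw [← Real.exp_add]; simp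
      rw [le_div_iff₀ hν]
      nlinarith
    rw [e, ← mul_assoc]
    refine mul_le_mul_of_nonneg_right ?_ h0.le
    linarith
  have hq : 0 ≤ (α - 1) + |γ| := by linarith [abs_nonneg γ]
  calc _ ≤ C * (Real.exp ν * weight ν ξ) * (((α - 1) + |γ|) * (2 + |ξ|)) :=
        mul_le_mul_of_nonneg_left hdist
          (mul_nonneg hC (mul_nonneg (Real.exp_pos _).le (weight_pos _ _).le))
    _ = C * Real.exp ν * ((α - 1) + |γ|) * ((2 + |ξ|) * weight ν ξ) := by ring
    _ ≤ C * Real.exp ν * ((α - 1) + |γ|) * ((2 + 2 / ν) * weight (ν / 2) ξ) :=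
        mul_le_mul_of_nonneg_left hw (mul_nonneg (mul_nonneg hC (Real.exp_pos _).le) hq)
    _ = _ := by ring

variable {ρ : ℝ} {f : E n → E n} {Φ₀ : ℝ → E n} {c₀ : ℝ} {φ₁ φ₂ φ₃ : ℝ → E n} {C ν : ℝ}

theorem Profile.continuous0 (h : Profile ρ f Φ₀ c₀ φ₁ φ₂ φ₃ C ν) : Continuous Φ₀ :=
  continuous_iff_continuousAt.2 fun ξ => (h.d0 ξ).continuousAt

theorem Profile.continuous1 (h : Profile ρ f Φ₀ c₀ φ₁ φ₂ φ₃ C ν) : Continuous φ₁ :=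
  continuous_iff_continuousAt.2 fun ξ => (h.d1 ξ).continuousAt

theorem Profile.continuous2 (h : Profile ρ f Φ₀ c₀ φ₁ φ₂ φ₃ C ν) : Continuous φ₂ :=
  continuous_iff_continuousAt.2 fun ξ => (h.d2 ξ).continuousAt

theorem Profile.memLp1 (h : Profile ρ f Φ₀ c₀ φ₁ φ₂ φ₃ C ν) : MemLp φ₁ 2 volume :=
  memLp_of_weight h.posν h.continuous1 h.bound1

/-- Size and derivatives of the perturbed profiles `ξ ↦ Φ₀ (α (ξ - γ))`. -/
theorem Profile.exists_dilate (h : Profile ρ f Φ₀ c₀ φ₁ φ₂ φ₃ C ν) :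
    ∃ D : ℝ, 0 < D ∧ ∀ α γ : ℝ, 1 ≤ α → α ≤ 2 → |γ| ≤ 1 → ∀ ξ,
      ‖Φ₀ (α * (ξ - γ)) - Φ₀ ξ‖ ≤ D * ((α - 1) + |γ|) * weight (ν / 2) ξ ∧
      ‖α • φ₁ (α * (ξ - γ)) - φ₁ ξ‖ ≤ D * ((α - 1) + |γ|) * weight (ν / 2) ξ ∧
      ‖(α * α) • φ₂ (α * (ξ - γ)) - φ₂ ξ‖ ≤ D * ((α - 1) + |γ|) * weight (ν / 2) ξ ∧
      ‖α • φ₁ (α * (ξ - γ))‖ ≤ D * weight (ν / 2) ξ ∧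
      ‖(α * α) • φ₂ (α * (ξ - γ))‖ ≤ D * weight (ν / 2) ξ := by
  set A := C * (Real.exp ν * (2 + 2 / ν)) with hA
  have hC := h.posC
  have hν := h.posν
  have pA : 0 < A := by positivity
  refine ⟨8 * A + 8 * C, by positivity, fun α γ hα hα' hγ ξ => ?_⟩
  set q := (α - 1) + |γ| with hq
  set m := weight (ν / 2) ξ with hm
  have q0 : 0 ≤ q := by linarith [abs_nonneg γ]
  have q2 : q ≤ 2 := by linarith
  have m0 : 0 < m := weight_pos _ _
  have e0 := norm_dilate_sub_le hC.le hν h.d0 h.bound1 hα hα' hγ ξ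
  have e1 := norm_dilate_sub_le hC.le hν h.d1 h.bound2 hα hα' hγ ξ
  have e2 := norm_dilate_sub_le hC.le hν h.d2 h.bound3 hα hα' hγ ξ
  rw [← hA, ← hq, ← hm] at e0 e1 e2
  have w : weight ν ξ ≤ m := weight_anti (by linarith) ξ
  have p1 : ‖φ₁ ξ‖ ≤ C * m := (h.bound1 ξ).trans (mul_le_mul_of_nonneg_left w hC.le)
  have p2 : ‖φ₂ ξ‖ ≤ C * m := (h.bound2 ξ).trans (mul_le_mul_of_nonneg_left w hC.le)
  have αq : α - 1 ≤ q := by linarith [abs_nonneg γ]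
  have Aqm : 0 ≤ A * q * m := by positivity
  have Cqm : 0 ≤ C * q * m := by positivity
  have Cm : 0 ≤ C * m := by positivity
  have Am : A * q * m ≤ 2 * (A * m) := by nlinarith [mul_pos pA m0]
  have Cm' : C * q * m ≤ 2 * (C * m) := by nlinarith [mul_pos hC m0]
  have r1 : ‖α • φ₁ (α * (ξ - γ)) - φ₁ ξ‖ ≤ 2 * (A * q * m) + C * q * m := by
    have : α • φ₁ (α * (ξ - γ)) - φ₁ ξ = α • (φ₁ (α * (ξ - γ)) - φ₁ ξ) + (α - 1) • φ₁ ξ := by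
      module
    rw [this]
    refine (norm_add_le _ _).trans ?_
    rw [norm_smul, norm_smul, Real.norm_of_nonneg (by linarith), Real.norm_of_nonneg (by linarith)]
    have t1 := mul_le_mul hα' e1 (norm_nonneg _) (by norm_num)
    have t2 := mul_le_mul αq p1 (norm_nonneg _) q0
    linarith
  have r2 : ‖(α * α) • φ₂ (α * (ξ - γ)) - φ₂ ξ‖ ≤ 4 * (A * q * m) + 3 * (C * q * m) := by
    have : (α * α) • φ₂ (α * (ξ - γ)) - φ₂ ξ =
        (α * α) • (φ₂ (α * (ξ - γ)) - φ₂ ξ) + (α * α - 1) • φ₂ ξ := by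
      module
    rw [this]
    refine (norm_add_le _ _).trans ?_
    rw [norm_smul, norm_smul, Real.norm_of_nonneg (by nlinarith),
      Real.norm_of_nonneg (by nlinarith)]
    have t1 := mul_le_mul (show α * α ≤ 4 by nlinarith) e2 (norm_nonneg _) (by norm_num)
    have t2 := mul_le_mul (show α * α - 1 ≤ 3 * q by nlinarith) p2 (norm_nonneg _) (by positivity)
    linarith
  have s1 := norm_le_norm_sub_add (α • φ₁ (α * (ξ - γ))) (φ₁ ξ)
  have s2 := norm_le_norm_sub_add ((α * α) • φ₂ (α * (ξ - γ))) (φ₂ ξ)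
  have x1 : (8 * A + 8 * C) * q * m = 8 * (A * q * m) + 8 * (C * q * m) := by ring
  have x2 : (8 * A + 8 * C) * m = 8 * (A * m) + 8 * (C * m) := by ring
  have Am0 : 0 ≤ A * m := by positivity
  refine ⟨?_, ?_, ?_, ?_, ?_⟩ <;> linarith

theorem Profile.hasDerivAt_dilate (h : Profile ρ f Φ₀ c₀ φ₁ φ₂ φ₃ C ν) (α γ ξ : ℝ) :
    HasDerivAt (fun ξ => Φ₀ (α * (ξ - γ))) (α • φ₁ (α * (ξ - γ))) ξ ∧
      HasDerivAt (fun ξ => α • φ₁ (α * (ξ - γ))) ((α * α) • φ₂ (α * (ξ - γ))) ξ := by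
  have h1 : HasDerivAt (fun ξ : ℝ => α * (ξ - γ)) α ξ := by
    simpa using ((hasDerivAt_id ξ).sub_const γ).const_mul α
  refine ⟨(h.d0 _).scomp ξ h1, ?_⟩
  have := ((h.d1 _).scomp ξ h1).const_smul α
  rw [smul_smul] at this
  exact this

theorem Profile.continuous_dilate (h : Profile ρ f Φ₀ c₀ φ₁ φ₂ φ₃ C ν) (α γ : ℝ) :
    Continuous (fun ξ => (α * α) • φ₂ (α * (ξ - γ))) := by
  have := h.continuous2
  fun_prop

end

/-! ### Twice continuously differentiable functions in `H²` -/

section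

variable {n : ℕ}

/-- `v` is a `C²` function in `H²`, with classical derivatives `v₁` and `v₂`. -/
structure IsC2H2 (v v₁ v₂ : ℝ → E n) : Prop where
  d0 : ∀ ξ, HasDerivAt v (v₁ ξ) ξ
  d1 : ∀ ξ, HasDerivAt v₁ (v₂ ξ) ξ
  cont2 : Continuous v₂
  memLp0 : MemLp v 2 volume
  memLp1 : MemLp v₁ 2 volume
  memLp2 : MemLp v₂ 2 volume

namespace IsC2H2

variable {v v₁ v₂ w w₁ w₂ : ℝ → E n}

theorem cont0 (h : IsC2H2 v v₁ v₂) : Continuous v :=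
  continuous_iff_continuousAt.2 fun ξ => (h.d0 ξ).continuousAt

theorem cont1 (h : IsC2H2 v v₁ v₂) : Continuous v₁ :=
  continuous_iff_continuousAt.2 fun ξ => (h.d1 ξ).continuousAt

theorem hasWeakDeriv0 (h : IsC2H2 v v₁ v₂) : HasWeakDeriv v v₁ :=
  hasWeakDeriv_of_hasDerivAt h.cont1 h.d0

theorem hasWeakDeriv1 (h : IsC2H2 v v₁ v₂) : HasWeakDeriv v₁ v₂ :=
  hasWeakDeriv_of_hasDerivAt h.cont2 h.d1

theorem memH2 (h : IsC2H2 v v₁ v₂) : MemH2 v :=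
  ⟨h.memLp0, _, h.hasWeakDeriv0, h.memLp1, _, h.hasWeakDeriv1, h.memLp2⟩

theorem sub (h : IsC2H2 v v₁ v₂) (h' : IsC2H2 w w₁ w₂) :
    IsC2H2 (fun ξ => v ξ - w ξ) (fun ξ => v₁ ξ - w₁ ξ) (fun ξ => v₂ ξ - w₂ ξ) where
  d0 ξ := (h.d0 ξ).sub (h'.d0 ξ)
  d1 ξ := (h.d1 ξ).sub (h'.d1 ξ)
  cont2 := h.cont2.sub h'.cont2
  memLp0 := h.memLp0.sub h'.memLp0
  memLp1 := h.memLp1.sub h'.memLp1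
  memLp2 := h.memLp2.sub h'.memLp2

theorem normH2_eq (h : IsC2H2 v v₁ v₂) :
    normH2 v = Real.sqrt (nrm v ^ 2 + nrm v₁ ^ 2 + nrm v₂ ^ 2) := by
  have e1 := h.hasWeakDeriv0.weakDeriv_ae
  have e2 := (h.hasWeakDeriv1.congr e1.symm).weakDeriv_ae
  unfold normH2
  rw [normL2_eq_nrm, normL2_eq_nrm, normL2_eq_nrm, nrm_congr e1, nrm_congr e2]

theorem normH2_le (h : IsC2H2 v v₁ v₂) : normH2 v ≤ nrm v + nrm v₁ + nrm v₂ := by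
  rw [h.normH2_eq]
  have h0 := nrm_nonneg v
  have h1 := nrm_nonneg v₁
  have h2 := nrm_nonneg v₂
  refine Real.sqrt_le_iff.2 ⟨by positivity, ?_⟩
  nlinarith [mul_nonneg h0 h1, mul_nonneg h0 h2, mul_nonneg h1 h2]

theorem le_normH2 (h : IsC2H2 v v₁ v₂) :
    nrm v ≤ normH2 v ∧ nrm v₁ ≤ normH2 v ∧ nrm v₂ ≤ normH2 v := by
  rw [h.normH2_eq]
  refine ⟨?_, ?_, ?_⟩ <;>
  · refine Real.le_sqrt_of_sq_le ?_
    nlinarith [sq_nonneg (nrm v), sq_nonneg (nrm v₁), sq_nonneg (nrm v₂)]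

end IsC2H2

theorem intervalIntegral_norm_le_nrm {u : ℝ → E n} (hu : MemLp u 2 volume) (x : ℝ) :
    ∫ t in x..(x + 1), ‖u t‖ ≤ nrm u := by
  rw [intervalIntegral.integral_of_le (by linarith)]
  set μ := (volume : Measure ℝ).restrict (Ioc x (x + 1)) with hμ
  have : IsProbabilityMeasure μ := ⟨by simp [hμ]⟩
  have hm : AEStronglyMeasurable u μ := hu.1.restrict
  rw [integral_norm_eq_lintegral_enorm hm, ← eLpNorm_one_eq_lintegral_enorm]
  refine ENNReal.toReal_mono hu.2.ne ?_
  exact (eLpNorm_le_eLpNorm_of_exponent_le (by norm_num) hm).trans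
    (eLpNorm_mono_measure _ Measure.restrict_le_self)

/-- The Sobolev embedding of `H¹` in `L^∞`: average the fundamental theorem of
calculus over an interval of length one. -/
theorem norm_le_nrm_add_nrm {v v₁ : ℝ → E n} (hd : ∀ ξ, HasDerivAt v (v₁ ξ) ξ)
    (hc : Continuous v₁) (h0 : MemLp v 2 volume) (h1 : MemLp v₁ 2 volume) (x : ℝ) :
    ‖v x‖ ≤ nrm v + nrm v₁ := by
  have cv : Continuous v := continuous_iff_continuousAt.2 fun ξ => (hd ξ).continuousAt
  have i0 : IntervalIntegrable (fun t => ‖v t‖) volume x (x + 1) := cv.norm.intervalIntegrable _ _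
  have i1 : IntervalIntegrable (fun t => ‖v₁ t‖) volume x (x + 1) :=
    hc.norm.intervalIntegrable _ _
  have key : ∀ y ∈ Icc x (x + 1), ‖v x‖ ≤ ‖v y‖ + ∫ t in x..(x + 1), ‖v₁ t‖ := by
    intro y hy
    have e := intervalIntegral.integral_eq_sub_of_hasDerivAt (fun t _ => hd t)
      (hc.intervalIntegrable x y)
    have b1 : ‖∫ t in x..y, v₁ t‖ ≤ ∫ t in x..y, ‖v₁ t‖ :=
      intervalIntegral.norm_integral_le_integral_norm hy.1
    have b2 : ∫ t in x..y, ‖v₁ t‖ ≤ ∫ t in x..(x + 1), ‖v₁ t‖ :=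
      intervalIntegral.integral_mono_interval le_rfl hy.1 hy.2
        (Eventually.of_forall fun _ => norm_nonneg _) i1
    have b3 : ‖v x‖ ≤ ‖v y‖ + ‖v y - v x‖ := by
      have := norm_sub_norm_le (v x) (v y)
      rw [norm_sub_rev] at this
      linarith
    rw [← e] at b3
    linarith
  have := intervalIntegral.integral_mono_on (a := x) (b := x + 1) (by linarith)
    (f := fun _ => ‖v x‖) (g := fun y => ‖v y‖ + ∫ t in x..(x + 1), ‖v₁ t‖)
    (by simp) (i0.add (by simp)) key
  rw [intervalIntegral.integral_add i0 (by simp)] at this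
  simp only [intervalIntegral.integral_const, add_sub_cancel_left, one_smul] at this
  linarith [intervalIntegral_norm_le_nrm h0 x, intervalIntegral_norm_le_nrm h1 x]

/-! ### Modified waves are classical solutions -/

variable {χlow χhigh : ℝ → ℝ} {ρ : ℝ} {f g : E n → E n} {Φ₀ : ℝ → E n} {c₀ : ℝ}
  {ψ : ℝ → E n} {K σ : ℝ} {Φ : ℝ → E n} {c : ℝ} {φ₁ φ₂ φ₃ : ℝ → E n} {C ν : ℝ}

theorem weakDeriv_comp_ae {Φ₁ : ℝ → E n} (hg : ContDiff ℝ 1 g) (hd : ∀ ξ, HasDerivAt Φ (Φ₁ ξ) ξ)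
    (hc : Continuous Φ₁) :
    weakDeriv (fun ζ => g (Φ ζ)) =ᵐ[volume] fun ξ => fderiv ℝ g (Φ ξ) (Φ₁ ξ) := by
  have cΦ : Continuous Φ := continuous_iff_continuousAt.2 fun ξ => (hd ξ).continuousAt
  refine weakDeriv_ae_of_hasDerivAt
    (((hg.continuous_fderiv (by norm_num)).comp cΦ).clm_apply hc) fun ξ => ?_
  exact ((hg.differentiable (by norm_num)) (Φ ξ)).hasFDerivAt.comp_hasDerivAt ξ (hd ξ)

/-- Elliptic regularity for modified waves: `Φ'` has a continuous representative, so the equation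
gives one for `Φ''` too. -/
theorem IsModifiedWave.exists_classical (hρ : ρ ≠ 0) (hf : Continuous f) (hg : ContDiff ℝ 1 g)
    (hp : Profile ρ f Φ₀ c₀ φ₁ φ₂ φ₃ C ν)
    (h : IsModifiedWave χlow χhigh ρ f g Φ₀ c₀ ψ K σ Φ c) :
    ∃ Φ₁ Φ₂ : ℝ → E n, (∀ ξ, HasDerivAt Φ (Φ₁ ξ) ξ) ∧ (∀ ξ, HasDerivAt Φ₁ (Φ₂ ξ) ξ) ∧
      IsC2H2 (fun ξ => Φ ξ - Φ₀ ξ) (fun ξ => Φ₁ ξ - φ₁ ξ) (fun ξ => Φ₂ ξ - φ₂ ξ) ∧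
      ∀ ξ, ρ • Φ₂ ξ + (kappa χlow χhigh ρ g σ Φ ψ)⁻¹ • (f (Φ ξ) + c • Φ₁ ξ +
        (σ ^ 2 * b χlow χhigh g Φ ψ) • fderiv ℝ g (Φ ξ) (Φ₁ ξ)) = 0 := by
  obtain ⟨m0, w, hw, mw, z, hz, mz⟩ := h.memH2
  obtain ⟨w', ew, pw⟩ := hz.exists_isPrimitive
  have hw' := hw.congr_deriv ew
  have pv := hw'.isPrimitive (h.continuous.sub hp.continuous0)
  have dv := fun x => pv.hasDerivAt pw.continuous x
  set Φ₁ : ℝ → E n := fun ξ => w' ξ + φ₁ ξ with hΦ₁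
  have dΦ : ∀ ξ, HasDerivAt Φ (Φ₁ ξ) ξ := fun ξ => by
    refine ((dv ξ).add (hp.d0 ξ)).congr_of_eventuallyEq (Eventually.of_forall fun x => ?_)
    simp
  have cΦ₁ : Continuous Φ₁ := pw.continuous.add hp.continuous1
  have heqn := h.eqn
  unfold J at heqn
  generalize kappa χlow χhigh ρ g σ Φ ψ = κ at heqn ⊢
  generalize σ ^ 2 * b χlow χhigh g Φ ψ = β at heqn ⊢
  set Φ₂ : ℝ → E n := fun ξ => -(ρ⁻¹ • κ⁻¹ • (f (Φ ξ) + c • Φ₁ ξ +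
        β • fderiv ℝ g (Φ ξ) (Φ₁ ξ))) with hΦ₂
  have cΦ₂ : Continuous Φ₂ := by
    have c1 : Continuous fun ξ => fderiv ℝ g (Φ ξ) (Φ₁ ξ) :=
      ((hg.continuous_fderiv (by norm_num)).comp h.continuous).clm_apply cΦ₁
    have c2 : Continuous fun ξ => f (Φ ξ) := hf.comp h.continuous
    exact ((((c2.add (cΦ₁.const_smul c)).add (c1.const_smul β)).const_smul κ⁻¹).const_smul ρ⁻¹).neg
  have wd1 : HasWeakDeriv Φ₁ (z + φ₂) :=
    pw.hasWeakDeriv.add (hasWeakDeriv_of_hasDerivAt hp.continuous2 hp.d1)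
  have e1 : weakDeriv Φ =ᵐ[volume] Φ₁ := weakDeriv_ae_of_hasDerivAt cΦ₁ dΦ
  have e2 := (wd1.congr e1.symm).weakDeriv_ae
  have ez : (z + φ₂) =ᵐ[volume] Φ₂ := by
    filter_upwards [e1, e2, weakDeriv_comp_ae hg dΦ cΦ₁, heqn] with ξ q1 q2 q3 q4
    rw [q1, q2, q3] at q4
    rw [hΦ₂]
    simp only
    rw [← neg_eq_of_add_eq_zero_right q4, smul_neg, neg_neg, smul_smul, inv_mul_cancel₀ hρ,
      one_smul]
  have dΦ₁ : ∀ ξ, HasDerivAt Φ₁ (Φ₂ ξ) ξ :=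
    fun ξ => ((wd1.isPrimitive cΦ₁).congr_deriv ez).hasDerivAt cΦ₂ ξ
  refine ⟨Φ₁, Φ₂, dΦ, dΦ₁, ⟨fun ξ => (dΦ ξ).sub (hp.d0 ξ), fun ξ => (dΦ₁ ξ).sub (hp.d1 ξ),
    cΦ₂.sub hp.continuous2, m0, ?_, ?_⟩, fun ξ => ?_⟩
  · refine (memLp_congr_ae ?_).1 mw
    filter_upwards [ew] with ξ hξ
    rw [hξ, hΦ₁]; simp
  · refine (memLp_congr_ae ?_).1 mz
    filter_upwards [ez] with ξ hξ
    rw [← hξ]; simp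
  · rw [hΦ₂]
    simp only
    rw [smul_neg, smul_smul, mul_inv_cancel₀ hρ, one_smul, neg_add_cancel]

/-! ### The cut-offs are inactive near the wave -/

variable {um up : E n} {Kg θ₀ : ℝ} {Φ₁ : ℝ → E n}

theorem Hg.norm_sub_le (hg : Hg g um up Kg) (x y : E n) : ‖g x - g y‖ ≤ Kg * ‖x - y‖ := by
  linarith [hg.lipschitz x y, norm_nonneg (fderiv ℝ g x - fderiv ℝ g y)]

theorem Hg.norm_fderiv_sub_le (hg : Hg g um up Kg) (x y : E n) :
    ‖fderiv ℝ g x - fderiv ℝ g y‖ ≤ Kg * ‖x - y‖ := by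
  linarith [hg.lipschitz x y, norm_nonneg (g x - g y)]

theorem Hg.memLp_comp_sub (hg : Hg g um up Kg) {u v : ℝ → E n} (hu : Continuous u)
    (hv : Continuous v) (hm : MemLp (fun ξ => u ξ - v ξ) 2 volume) :
    MemLp (fun ξ => g (u ξ) - g (v ξ)) 2 volume ∧
      nrm (fun ξ => g (u ξ) - g (v ξ)) ≤ Kg * nrm (fun ξ => u ξ - v ξ) := by
  have cg := hg.contDiff.continuous
  have hm' : MemLp (fun ξ => Kg • ‖u ξ - v ξ‖) 2 volume := hm.norm.const_smul Kg
  refine ⟨hm'.mono' ((cg.comp hu).sub (cg.comp hv)).aestronglyMeasurable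
    (Eventually.of_forall fun ξ => hg.norm_sub_le _ _), ?_⟩
  refine (nrm_mono hm' (Eventually.of_forall fun ξ => hg.norm_sub_le _ _)).trans (le_of_eq ?_)
  rw [nrm_smul, nrm_norm, abs_of_pos hg.pos]

/-- Near `Φ₀` both cut-offs in `b` act as the identity. -/
theorem b_eq_of_near (hg : Hg g um up Kg) (hlow : IsCutoffLow χlow)
    (hhigh : IsCutoffHigh (Kip g Kg Φ₀ ψ) χhigh) (mψ : MemLp ψ 2 volume)
    (hp : Profile ρ f Φ₀ c₀ φ₁ φ₂ φ₃ C ν) (hψ : innerL2 φ₁ ψ = 1)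
    (hθ : ∀ ξ, g (Φ₀ ξ) = θ₀ • φ₁ ξ) (hd : ∀ ξ, HasDerivAt Φ (Φ₁ ξ) ξ) (hc : Continuous Φ₁)
    (m0 : MemLp (fun ξ => Φ ξ - Φ₀ ξ) 2 volume) (m1 : MemLp (fun ξ => Φ₁ ξ - φ₁ ξ) 2 volume)
    (n0 : nrm (fun ξ => Φ ξ - Φ₀ ξ) ≤ 2) (n1 : nrm (fun ξ => Φ₁ ξ - φ₁ ξ) * nrm ψ ≤ 1 / 2) :
    1 / 2 ≤ innerL2 Φ₁ ψ ∧ |innerL2 (fun ξ => g (Φ ξ)) ψ| ≤ Kip g Kg Φ₀ ψ ∧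
      b χlow χhigh g Φ ψ = -((innerL2 Φ₁ ψ)⁻¹ * innerL2 (fun ξ => g (Φ ξ)) ψ) ∧
      MemLp Φ₁ 2 volume ∧ MemLp (fun ξ => g (Φ ξ)) 2 volume := by
  have cΦ : Continuous Φ := continuous_iff_continuousAt.2 fun ξ => (hd ξ).continuousAt
  have i1 : 1 / 2 ≤ innerL2 Φ₁ ψ := by
    have e : innerL2 Φ₁ ψ = innerL2 (fun ξ => (Φ₁ ξ - φ₁ ξ) + φ₁ ξ) ψ := by simp
    rw [innerL2_add_left m1 hp.memLp1 mψ, hψ] at e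
    have := (abs_le.1 (abs_innerL2_le m1 mψ)).1
    linarith
  have mg0 : MemLp (fun ξ => g (Φ₀ ξ)) 2 volume := by
    simp only [hθ]; exact memLp_smul _ hp.memLp1
  obtain ⟨mg, ng⟩ := hg.memLp_comp_sub cΦ hp.continuous0 m0
  have mΦ₁ : MemLp Φ₁ 2 volume := by
    have := m1.add hp.memLp1
    refine (memLp_congr_ae (Eventually.of_forall fun ξ => ?_)).1 this
    simp
  have mgΦ : MemLp (fun ξ => g (Φ ξ)) 2 volume := by
    have := mg.add mg0
    refine (memLp_congr_ae (Eventually.of_forall fun ξ => ?_)).1 this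
    simp
  have i2 : |innerL2 (fun ξ => g (Φ ξ)) ψ| ≤ Kip g Kg Φ₀ ψ := by
    refine (abs_innerL2_le mgΦ mψ).trans ?_
    unfold Kip
    refine mul_le_mul_of_nonneg_right ?_ (nrm_nonneg _)
    have e : nrm (fun ξ => g (Φ ξ)) = nrm (fun ξ => (g (Φ ξ) - g (Φ₀ ξ)) + g (Φ₀ ξ)) := by simp
    rw [e]
    refine (nrm_add_le mg mg0).trans ?_
    have := mul_le_mul_of_nonneg_left n0 hg.pos.le
    change _ ≤ nrm (fun ξ => g (Φ₀ ξ)) + 2 * Kg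
    linarith
  refine ⟨i1, i2, ?_, mΦ₁, mgΦ⟩
  unfold b
  rw [innerL2_congr (weakDeriv_ae_of_hasDerivAt hc hd) (ae_eq_refl ψ), hlow.eq_self _ i1,
    hhigh.eq_self _ i2]

theorem b_eq_neg {μ : ℝ} (hμ : ∀ ξ, g (Φ ξ) = μ • Φ₁ ξ) (h1 : 1 / 2 ≤ innerL2 Φ₁ ψ)
    (hb : b χlow χhigh g Φ ψ = -((innerL2 Φ₁ ψ)⁻¹ * innerL2 (fun ξ => g (Φ ξ)) ψ)) :
    b χlow χhigh g Φ ψ = -μ := by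
  rw [hb]
  simp only [hμ]
  rw [innerL2_smul_left]
  field_simp

end

/-! ### The dilated waves -/

section

variable {n : ℕ}

variable {χlow χhigh : ℝ → ℝ} {ρ : ℝ} {f g : E n → E n} {Φ₀ : ℝ → E n} {c₀ : ℝ}
  {ψ : ℝ → E n} {σ : ℝ} {φ₁ φ₂ φ₃ : ℝ → E n} {C ν : ℝ} {um up : E n} {Kg θ₀ α γ : ℝ}

theorem Profile.isC2H2_dilate (h : Profile ρ f Φ₀ c₀ φ₁ φ₂ φ₃ C ν) (hα : 1 ≤ α) (hα' : α ≤ 2)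
    (hγ : |γ| ≤ 1) :
    IsC2H2 (fun ξ => Φ₀ (α * (ξ - γ)) - Φ₀ ξ) (fun ξ => α • φ₁ (α * (ξ - γ)) - φ₁ ξ)
      (fun ξ => (α * α) • φ₂ (α * (ξ - γ)) - φ₂ ξ) := by
  obtain ⟨D, -, hb⟩ := h.exists_dilate
  have hν := half_pos h.posν
  have d0 := fun ξ => (h.hasDerivAt_dilate α γ ξ).1.sub (h.d0 ξ)
  have d1 := fun ξ => (h.hasDerivAt_dilate α γ ξ).2.sub (h.d1 ξ)
  have c2 := (h.continuous_dilate α γ).sub h.continuous2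
  exact ⟨d0, d1, c2,
    memLp_of_weight hν (continuous_iff_continuousAt.2 fun ξ => (d0 ξ).continuousAt)
      fun ξ => (hb α γ hα hα' hγ ξ).1,
    memLp_of_weight hν (continuous_iff_continuousAt.2 fun ξ => (d1 ξ).continuousAt)
      fun ξ => (hb α γ hα hα' hγ ξ).2.1,
    memLp_of_weight hν c2 fun ξ => (hb α γ hα hα' hγ ξ).2.2.1⟩

theorem g_dilate (hα : α ≠ 0) (hθ : ∀ ξ, g (Φ₀ ξ) = θ₀ • φ₁ ξ) (ξ : ℝ) :
    g (Φ₀ (α * (ξ - γ))) = (α⁻¹ * θ₀) • α • φ₁ (α * (ξ - γ)) := by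
  rw [hθ, smul_smul]
  congr 1
  field_simp

/-- The dilated wave solves the modified equation with `b = -α⁻¹ θ₀`: since `g(Φ₀)` is parallel to
`Φ₀'`, the noise terms are multiples of the second derivative, and `α² = 1 + σ² θ₀² / (2 ρ)`
balances them. -/
theorem Profile.dilate_ode (h : Profile ρ f Φ₀ c₀ φ₁ φ₂ φ₃ C ν) (hρ : 0 < ρ) (hα : 1 ≤ α)
    (hα2 : α ^ 2 = 1 + 1 / (2 * ρ) * σ ^ 2 * θ₀ ^ 2) (hg : Differentiable ℝ g)
    (hθ : ∀ ξ, g (Φ₀ ξ) = θ₀ • φ₁ ξ) (ξ : ℝ) :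
    (ρ * (1 + 1 / (2 * ρ) * σ ^ 2 * (-(α⁻¹ * θ₀)) ^ 2)) • (α * α) • φ₂ (α * (ξ - γ)) +
      (f (Φ₀ (α * (ξ - γ))) + (α⁻¹ * c₀) • α • φ₁ (α * (ξ - γ)) +
        (σ ^ 2 * (-(α⁻¹ * θ₀))) • fderiv ℝ g (Φ₀ (α * (ξ - γ))) (α • φ₁ (α * (ξ - γ)))) = 0 := by
  have α0 : α ≠ 0 := by linarith
  obtain ⟨d0, d1⟩ := h.hasDerivAt_dilate α γ ξ
  have e : fderiv ℝ g (Φ₀ (α * (ξ - γ))) (α • φ₁ (α * (ξ - γ))) =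
      (α⁻¹ * θ₀) • (α * α) • φ₂ (α * (ξ - γ)) := by
    have q1 := (hg (Φ₀ (α * (ξ - γ)))).hasFDerivAt.comp_hasDerivAt ξ d0
    have q2 := d1.const_smul (α⁻¹ * θ₀)
    refine q1.unique (q2.congr_of_eventuallyEq (Eventually.of_forall fun x => ?_))
    exact g_dilate α0 hθ x
  rw [e, ← sub_eq_zero_of_eq (h.ode (α * (ξ - γ)))]
  have k : (ρ * (1 + 1 / (2 * ρ) * σ ^ 2 * (-(α⁻¹ * θ₀)) ^ 2)) * (α * α) +
      (σ ^ 2 * (-(α⁻¹ * θ₀))) * ((α⁻¹ * θ₀) * (α * α)) = ρ := by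
    have : (ρ * (1 + 1 / (2 * ρ) * σ ^ 2 * (-(α⁻¹ * θ₀)) ^ 2)) * (α * α) +
      (σ ^ 2 * (-(α⁻¹ * θ₀))) * ((α⁻¹ * θ₀) * (α * α)) =
        ρ * α ^ 2 - σ ^ 2 * θ₀ ^ 2 / 2 := by
      field_simp
      ring
    rw [this, hα2]
    field_simp
    ring
  have k1 : (α⁻¹ * c₀) * α = c₀ := by field_simp
  rw [smul_smul, smul_smul, smul_smul, smul_smul, k1]
  nth_rewrite 3 [← k]
  module

theorem dilation_le (hα : 1 ≤ α)
    (hα2 : α ^ 2 = 1 + 1 / (2 * ρ) * σ ^ 2 * θ₀ ^ 2) :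
    α - 1 ≤ θ₀ ^ 2 / (2 * ρ) * σ ^ 2 := by
  have : θ₀ ^ 2 / (2 * ρ) * σ ^ 2 = 1 / (2 * ρ) * σ ^ 2 * θ₀ ^ 2 := by ring
  rw [this]
  nlinarith

theorem Profile.exists_isModifiedWave_dilate (hρ : 0 < ρ)
    (hg : Hg g um up Kg) (hlow : IsCutoffLow χlow)
    (hhigh : IsCutoffHigh (Kip g Kg Φ₀ ψ) χhigh) (mψ : MemLp ψ 2 volume)
    (hp : Profile ρ f Φ₀ c₀ φ₁ φ₂ φ₃ C ν) (hψ : innerL2 φ₁ ψ = 1)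
    (hθ : ∀ ξ, g (Φ₀ ξ) = θ₀ • φ₁ ξ) :
    ∃ K₀ : ℝ, 0 < K₀ ∧ ∃ ε : ℝ, 0 < ε ∧ ∀ K σ α : ℝ, K₀ ≤ K → 1 ≤ α → σ ^ 2 ≤ ε →
      α ^ 2 = 1 + 1 / (2 * ρ) * σ ^ 2 * θ₀ ^ 2 →
      IsModifiedWave χlow χhigh ρ f g Φ₀ c₀ ψ K σ (fun ξ => Φ₀ (α * ξ)) (α⁻¹ * c₀) := by
  obtain ⟨D, hD, hb⟩ := hp.exists_dilate
  set W := nrm (weight (ν / 2)) with hW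
  have W0 : 0 ≤ W := nrm_nonneg _
  set t := θ₀ ^ 2 / (2 * ρ) with ht
  have t0 : 0 ≤ t := by positivity
  have P0 : 0 ≤ nrm ψ := nrm_nonneg _
  refine ⟨(3 * (D * W) + |c₀|) * t + 1, by positivity,
    1 / (2 * (1 + t * (1 + D * W * (1 + nrm ψ)))), by positivity, ?_⟩
  intro K σ α hK hα hσ hα2
  have αt : α - 1 ≤ t * σ ^ 2 := dilation_le hα hα2
  have hσ' : σ ^ 2 * (1 + t * (1 + D * W * (1 + nrm ψ))) ≤ 1 / 2 := by
    rw [le_div_iff₀ (by positivity)] at hσ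
    linarith
  have s0 := sq_nonneg σ
  have tσ : t * σ ^ 2 * (1 + D * W * (1 + nrm ψ)) ≤ 1 / 2 := by nlinarith
  have tσ0 : 0 ≤ t * σ ^ 2 := by positivity
  have DW : 0 ≤ D * W := by positivity
  have small : (α - 1) * (1 + D * W * (1 + nrm ψ)) ≤ 1 / 2 :=
    (mul_le_mul_of_nonneg_right αt (by positivity)).trans tσ
  have α1 : 0 ≤ α - 1 := by linarith
  have hα' : α ≤ 2 := by
    nlinarith [mul_nonneg α1 (show 0 ≤ D * W * (1 + nrm ψ) by positivity)]
  have α0 : α ≠ 0 := by linarith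
  have hC := hp.isC2H2_dilate (γ := 0) hα hα' (by simp)
  have hd := fun ξ => hp.hasDerivAt_dilate α 0 ξ
  have hode := fun ξ => hp.dilate_ode (σ := σ) (γ := 0) hρ hα hα2
    (hg.contDiff.differentiable (by norm_num)) hθ ξ
  have hgU := fun ξ => g_dilate (γ := 0) α0 hθ ξ
  have hbb := fun ξ => hb α 0 hα hα' (by simp) ξ
  simp only [sub_zero, abs_zero, add_zero] at hC hd hode hgU hbb
  have nw : ∀ u : ℝ → E n, (∀ ξ, ‖u ξ‖ ≤ D * (α - 1) * weight (ν / 2) ξ) →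
      nrm u ≤ D * (α - 1) * W := fun u hu => by
    have := nrm_mono ((memLp_weight (half_pos hp.posν)).const_mul (D * (α - 1)))
      (Eventually.of_forall hu)
    refine this.trans (le_of_eq ?_)
    rw [show (fun x => D * (α - 1) * weight (ν / 2) x) =
      fun x => (D * (α - 1)) • weight (ν / 2) x from rfl, nrm_smul, abs_of_nonneg (by positivity)]
  have n0 := nw _ fun ξ => (hbb ξ).1
  have n1 := nw _ fun ξ => (hbb ξ).2.1
  have n2 := nw _ fun ξ => (hbb ξ).2.2.1
  have q0 : 0 ≤ (α - 1) * (D * W) := by positivity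
  have q1 : 0 ≤ (α - 1) * (D * W) * nrm ψ := by positivity
  have n0' : nrm (fun ξ => Φ₀ (α * ξ) - Φ₀ ξ) ≤ 2 := by nlinarith
  have n1' : nrm (fun ξ => α • φ₁ (α * ξ) - φ₁ ξ) * nrm ψ ≤ 1 / 2 := by
    have := mul_le_mul_of_nonneg_right n1 P0
    nlinarith
  have c1 : Continuous fun ξ => α • φ₁ (α * ξ) :=
    continuous_iff_continuousAt.2 fun ξ => (hd ξ).2.continuousAt
  have cU : Continuous fun ξ => Φ₀ (α * ξ) :=
    continuous_iff_continuousAt.2 fun ξ => (hd ξ).1.continuousAt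
  obtain ⟨i1, -, eb, -, -⟩ := b_eq_of_near hg hlow hhigh mψ hp hψ hθ (fun ξ => (hd ξ).1) c1
    hC.memLp0 hC.memLp1 n0' n1'
  have eb' := b_eq_neg hgU i1 eb
  refine ⟨cU, hC.memH2, ?_, ?_⟩
  · have c2 : Continuous fun ξ => (α * α) • φ₂ (α * ξ) := by
      have := hp.continuous2; fun_prop
    have e1 := weakDeriv_ae_of_hasDerivAt c1 (fun ξ => (hd ξ).1)
    have e2 := ((hasWeakDeriv_of_hasDerivAt c2 (fun ξ => (hd ξ).2)).congr e1.symm).weakDeriv_ae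
    have e3 := weakDeriv_comp_ae (hg.contDiff.of_le (by norm_num)) (fun ξ => (hd ξ).1) c1
    filter_upwards [e1, e2, e3] with ξ h1 h2 h3
    unfold J kappa
    rw [h1, h2, h3, eb']
    set κ := 1 + 1 / (2 * ρ) * σ ^ 2 * (-(α⁻¹ * θ₀)) ^ 2 with hκ
    have κ0 : 0 < κ := by positivity
    have := congrArg (fun x => κ⁻¹ • x) (hode ξ)
    simp only [smul_zero, smul_add κ⁻¹ ((ρ * κ) • _)] at this
    rw [smul_smul, show κ⁻¹ * (ρ * κ) = ρ by field_simp] at this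
    exact this
  · have hH := hC.normH2_le
    change normH2 (fun ξ => Φ₀ (α * ξ) - Φ₀ ξ) + _ ≤ _
    have hc : |α⁻¹ * c₀ - c₀| ≤ |c₀| * (α - 1) := by
      rw [show α⁻¹ * c₀ - c₀ = -(c₀ * (1 - α⁻¹)) by ring, abs_neg, abs_mul]
      refine mul_le_mul_of_nonneg_left ?_ (abs_nonneg _)
      have i0 : α⁻¹ ≤ 1 := inv_le_one_of_one_le₀ hα
      rw [abs_of_nonneg (by linarith)]
      have : α⁻¹ * α = 1 := inv_mul_cancel₀ α0
      nlinarith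
    have k1 : (3 * (D * W) + |c₀|) * (α - 1) ≤ (3 * (D * W) + |c₀|) * (t * σ ^ 2) :=
      mul_le_mul_of_nonneg_left αt (by positivity)
    have k2 := mul_le_mul_of_nonneg_right hK s0
    have k3 : (3 * (D * W) + |c₀|) * (α - 1) = 3 * (D * (α - 1) * W) + |c₀| * (α - 1) := by ring
    have k4 : ((3 * (D * W) + |c₀|) * t + 1) * σ ^ 2 =
        (3 * (D * W) + |c₀|) * (t * σ ^ 2) + σ ^ 2 := by ring
    linarith

/-- The phase condition can be met: near `Φ₀`, and for `α` near `1`, some small translate of the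
dilated wave differs from `Φ` by a function orthogonal to `ψ`. -/
theorem Profile.exists_phase (hp : Profile ρ f Φ₀ c₀ φ₁ φ₂ φ₃ C ν) (mψ : MemLp ψ 2 volume)
    (hψ : innerL2 φ₁ ψ = 1) {η : ℝ} (hη : 0 < η) (hη1 : η ≤ 1) :
    ∃ δ : ℝ, 0 < δ ∧ ∀ (α : ℝ) (Φ : ℝ → E n), 1 ≤ α → α ≤ 2 → α - 1 ≤ δ →
      MemLp (fun ξ => Φ ξ - Φ₀ ξ) 2 volume → nrm (fun ξ => Φ ξ - Φ₀ ξ) ≤ δ →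
      ∃ γ : ℝ, |γ| ≤ η ∧ innerL2 (fun ξ => Φ ξ - Φ₀ (α * (ξ - γ))) ψ = 0 := by
  obtain ⟨D, hD, hb⟩ := hp.exists_dilate
  set W := nrm (weight (ν / 2)) with hW
  have mW := memLp_weight (half_pos hp.posν)
  set P : ℝ × ℝ → ℝ := fun a => innerL2 (fun ξ => Φ₀ (a.1 * (ξ - a.2)) - Φ₀ ξ) ψ with hP
  have c0 := hp.continuous0
  have cP : ContinuousOn P (Icc 1 2 ×ˢ Icc (-1) 1) := by
    refine continuousOn_of_dominated (bound := fun ξ => D * 2 * (weight (ν / 2) ξ * ‖ψ ξ‖))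
      (fun a _ => ?_) (fun a ha => ?_) ?_ ?_
    · have : Continuous fun ξ => Φ₀ (a.1 * (ξ - a.2)) - Φ₀ ξ := by fun_prop
      exact this.aestronglyMeasurable.inner mψ.1
    · refine Eventually.of_forall fun ξ => ?_
      obtain ⟨⟨a1, a2⟩, a3⟩ := ha
      have a4 := abs_le.2 a3
      refine (norm_inner_le_norm _ _).trans ?_
      rw [← mul_assoc]
      refine mul_le_mul_of_nonneg_right ((hb a.1 a.2 a1 a2 a4 ξ).1.trans ?_) (norm_nonneg _)
      refine mul_le_mul_of_nonneg_right ?_ (weight_pos _ _).le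
      exact mul_le_mul_of_nonneg_left (by linarith) hD.le
    · exact (mW.integrable_mul mψ.norm).const_mul _
    · refine Eventually.of_forall fun ξ => Continuous.continuousOn ?_
      have : Continuous fun a : ℝ × ℝ => Φ₀ (a.1 * (ξ - a.2)) - Φ₀ ξ := by fun_prop
      exact this.inner continuous_const
  have expand : ∀ γ : ℝ, |γ| ≤ 1 → |P (1, γ) + γ| ≤ D * W * nrm ψ * γ ^ 2 := by
    intro γ hγ
    set Q : ℝ → E n := fun ξ => (Φ₀ (1 * (ξ - γ)) - Φ₀ ξ) + γ • φ₁ ξ with hQ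
    have bQ : ∀ ξ, ‖Q ξ‖ ≤ (D * γ ^ 2) • weight (ν / 2) ξ := by
      intro ξ
      have hh : ∀ s, HasDerivAt (fun s => Φ₀ (ξ - s) + s • φ₁ ξ) (-φ₁ (ξ - s) + φ₁ ξ) s := by
        intro s
        have h1 : HasDerivAt (fun s : ℝ => ξ - s) (-1) s := by
          simpa using (hasDerivAt_id s).const_sub ξ
        have h2 := (hp.d0 (ξ - s)).scomp s h1
        have h3 := (hasDerivAt_id s).smul_const (φ₁ ξ)
        rw [neg_smul, one_smul] at h2
        rw [one_smul] at h3
        exact h2.add h3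
      have hbd : ∀ s ∈ uIcc 0 γ, ‖-φ₁ (ξ - s) + φ₁ ξ‖ ≤ D * |γ| * weight (ν / 2) ξ := by
        intro s hs
        have sγ : |s| ≤ |γ| := by
          rcases mem_uIcc.1 hs with ⟨h1, h2⟩ | ⟨h1, h2⟩
          · rw [abs_of_nonneg h1, abs_of_nonneg (h1.trans h2)]; exact h2
          · rw [abs_of_nonpos h2, abs_of_nonpos (h1.trans h2)]; linarith
        have := (hb 1 s le_rfl (by norm_num) (sγ.trans hγ) ξ).2.1
        rw [one_smul, one_mul, sub_self, zero_add] at this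
        rw [neg_add_eq_sub, norm_sub_rev]
        refine this.trans (mul_le_mul_of_nonneg_right ?_ (weight_pos _ _).le)
        exact mul_le_mul_of_nonneg_left sγ hD.le
      have := (convex_uIcc 0 γ).norm_image_sub_le_of_norm_hasDerivWithin_le
        (fun s _ => (hh s).hasDerivWithinAt) hbd left_mem_uIcc right_mem_uIcc
      simp only [sub_zero, zero_smul, add_zero, Real.norm_eq_abs] at this
      rw [hQ]
      simp only [one_mul]
      rw [sub_add_eq_add_sub]
      refine this.trans (le_of_eq ?_)
      rw [← sq_abs γ, smul_eq_mul]; ring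
    have mU := (hp.isC2H2_dilate (α := 1) le_rfl (by norm_num) hγ).memLp0
    have mQ : MemLp Q 2 volume := mU.add (memLp_smul γ hp.memLp1)
    have e : P (1, γ) + γ = innerL2 Q ψ := by
      rw [hQ, innerL2_add_left mU (memLp_smul γ hp.memLp1) mψ, innerL2_smul_left, hψ, mul_one]
    rw [e]
    refine (abs_innerL2_le mQ mψ).trans ?_
    have := nrm_mono (mW.const_smul (D * γ ^ 2)) (Eventually.of_forall bQ)
    have e2 : nrm ((D * γ ^ 2) • weight (ν / 2)) = D * γ ^ 2 * W := by
      have := nrm_smul (D * γ ^ 2) (weight (ν / 2))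
      rw [abs_of_nonneg (by positivity)] at this
      exact this
    rw [e2] at this
    refine (mul_le_mul_of_nonneg_right this (nrm_nonneg ψ)).trans (le_of_eq (by ring))
  have S0 : 0 ≤ D * W * nrm ψ := mul_nonneg (mul_nonneg hD.le (nrm_nonneg _)) (nrm_nonneg _)
  set S := D * W * nrm ψ with hS
  set γ₀ := min η (1 / (2 * (S + 1))) with hγ₀
  have γ0 : 0 < γ₀ := lt_min hη (by positivity)
  have γη : γ₀ ≤ η := min_le_left _ _
  have γS : S * γ₀ ^ 2 ≤ γ₀ / 2 := by
    have : γ₀ ≤ 1 / (2 * (S + 1)) := min_le_right _ _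
    rw [le_div_iff₀ (by positivity)] at this
    nlinarith
  have p1 : P (1, γ₀) ≤ -(γ₀ / 2) := by
    have := (abs_le.1 (expand γ₀ (by rw [abs_of_pos γ0]; linarith))).2
    linarith
  have p2 : γ₀ / 2 ≤ P (1, -γ₀) := by
    have := (abs_le.1 (expand (-γ₀) (by rw [abs_neg, abs_of_pos γ0]; linarith))).1
    rw [neg_sq] at this
    linarith
  have near : ∀ γ, |γ| ≤ 1 → ∃ δ > 0, ∀ α, 1 ≤ α → α ≤ 2 → α - 1 < δ →
      |P (α, γ) - P (1, γ)| < γ₀ / 4 := by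
    intro γ hγ
    have hc : ContinuousWithinAt (fun α : ℝ => P (α, γ)) (Icc 1 2) 1 := by
      have := cP.comp (f := fun α : ℝ => (α, γ)) (s := Icc 1 2) (by fun_prop)
        (fun α hα => ⟨hα, abs_le.1 hγ⟩)
      exact this 1 (by simp)
    obtain ⟨δ, hδ, h⟩ := Metric.continuousWithinAt_iff.1 hc (γ₀ / 4) (by positivity)
    refine ⟨δ, hδ, fun α h1 h2 h3 => h ⟨h1, h2⟩ ?_⟩
    rw [Real.dist_eq, abs_of_nonneg (by linarith)]
    exact h3
  obtain ⟨δ₁, hδ₁, h1⟩ := near γ₀ (by rw [abs_of_pos γ0]; linarith)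
  obtain ⟨δ₂, hδ₂, h2⟩ := near (-γ₀) (by rw [abs_neg, abs_of_pos γ0]; linarith)
  refine ⟨min (min (δ₁ / 2) (δ₂ / 2)) (γ₀ / (4 * (nrm ψ + 1))),
    lt_min (lt_min (by positivity) (by positivity))
      (div_pos γ0 (by linarith [nrm_nonneg ψ])), ?_⟩
  intro α Φ hα hα' hαδ mΦ nΦ
  have a1 : α - 1 < δ₁ := by
    linarith [hαδ.trans ((min_le_left _ _).trans (min_le_left _ _))]
  have a2 : α - 1 < δ₂ := by
    linarith [hαδ.trans ((min_le_left _ _).trans (min_le_right _ _))]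
  have nΦ' : nrm (fun ξ => Φ ξ - Φ₀ ξ) * nrm ψ ≤ γ₀ / 4 := by
    have := nΦ.trans (min_le_right _ _)
    rw [le_div_iff₀ (by linarith [nrm_nonneg ψ])] at this
    nlinarith [nrm_nonneg (fun ξ => Φ ξ - Φ₀ ξ), nrm_nonneg ψ]
  have iΦ := abs_le.1 ((abs_innerL2_le mΦ mψ).trans nΦ')
  set I := innerL2 (fun ξ => Φ ξ - Φ₀ ξ) ψ
  have q1 := (abs_lt.1 (h1 α hα hα' a1)).2
  have q2 := (abs_lt.1 (h2 α hα hα' a2)).1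
  have cm : ContinuousOn (fun γ => I - P (α, γ)) (Icc (-γ₀) γ₀) := by
    refine continuousOn_const.sub (cP.comp (f := fun γ : ℝ => (α, γ)) (by fun_prop) ?_)
    intro γ hγ
    exact ⟨⟨hα, hα'⟩, by linarith [hγ.1], by linarith [hγ.2]⟩
  obtain ⟨γ, hγ, e⟩ := intermediate_value_Icc (by linarith) cm
    (show (0 : ℝ) ∈ Icc (I - P (α, -γ₀)) (I - P (α, γ₀)) from
      ⟨by linarith, by linarith⟩)
  have hγ1 : |γ| ≤ γ₀ := abs_le.2 hγ
  refine ⟨γ, hγ1.trans γη, ?_⟩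
  rw [← e, hP]
  simp only
  rw [← innerL2_sub_left mΦ
    (hp.isC2H2_dilate hα hα' (hγ1.trans (γη.trans hη1))).memLp0 mψ]
  simp

end

/-! ### Rigidity of modified waves -/

section

variable {n : ℕ}

variable {χlow χhigh : ℝ → ℝ} {ρ : ℝ} {f g : E n → E n} {Φ₀ : ℝ → E n} {c₀ : ℝ}
  {ψ : ℝ → E n} {φ₁ φ₂ φ₃ : ℝ → E n} {C ν : ℝ} {um up : E n} {Kg θ₀ : ℝ}

theorem norm_taylor_le {Lf R : ℝ} (df : Differentiable ℝ f) (hLf : 0 ≤ Lf)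
    (lip : ∀ x y, ‖x‖ ≤ R → ‖y‖ ≤ R → ‖fderiv ℝ f x - fderiv ℝ f y‖ ≤ Lf * ‖x - y‖)
    {P U p : E n} (hP : ‖P‖ ≤ R) (hU : ‖U‖ ≤ R) (hp : ‖p‖ ≤ R) :
    ‖f P - f U - fderiv ℝ f p (P - U)‖ ≤ Lf * (‖P - U‖ + ‖U - p‖) * ‖P - U‖ := by
  refine (convex_segment U P).norm_image_sub_le_of_norm_fderiv_le' (fun x _ => df x)
    (fun x hx => ?_) (left_mem_segment ℝ U P) (right_mem_segment ℝ U P)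
  have hxR : ‖x‖ ≤ R := by
    have := (convex_closedBall (0 : E n) R).segment_subset (by simpa using hU)
      (by simpa using hP) hx
    simpa using this
  refine (lip x p hxR hp).trans (mul_le_mul_of_nonneg_left ?_ hLf)
  have h1 : ‖x - U‖ ≤ ‖P - U‖ := by
    have := norm_sub_le_of_mem_segment hx
    simpa [norm_sub_rev] using this
  exact (norm_sub_le_norm_sub_add_norm_sub x U p).trans (by linarith)

/-- The difference of the profile equations of two waves `P` and `U` with coefficients
`(b, c)` and `(b', c')`, at one point: up to terms that carry a factor `τ`, it is the linearised
operator applied to `P - U` plus `(c - c') p₁`. -/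
theorem norm_remainder_le {b b' c c' c₀ σ τ B D R Lf m : ℝ} (hρ : 0 < ρ)
    (df : Differentiable ℝ f) (hLf : 0 ≤ Lf)
    (lip : ∀ x y, ‖x‖ ≤ R → ‖y‖ ≤ R → ‖fderiv ℝ f x - fderiv ℝ f y‖ ≤ Lf * ‖x - y‖)
    (hg : Hg g um up Kg) {P P₁ P₂ U U₁ U₂ p p₁ : E n}
    (eP : (ρ * (1 + 1 / (2 * ρ) * σ ^ 2 * b ^ 2)) • P₂ +
      (f P + c • P₁ + (σ ^ 2 * b) • fderiv ℝ g P P₁) = 0)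
    (eU : (ρ * (1 + 1 / (2 * ρ) * σ ^ 2 * b' ^ 2)) • U₂ +
      (f U + c' • U₁ + (σ ^ 2 * b') • fderiv ℝ g U U₁) = 0)
    (hP : ‖P‖ ≤ R) (hU : ‖U‖ ≤ R) (hp : ‖p‖ ≤ R) (hb : |b| ≤ B) (hb' : |b'| ≤ B)
    (hP₁ : ‖P₁‖ ≤ B) (hPU : ‖P - U‖ ≤ D * τ) (hUp : ‖U - p‖ ≤ D * τ)
    (hU₁ : ‖U₁‖ ≤ D * m) (hU₂ : ‖U₂‖ ≤ D * m) (hU₁p : ‖U₁ - p₁‖ ≤ D * τ * m)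
    (hc : |c - c₀| ≤ τ) (hσ : σ ^ 2 ≤ τ) (hB : 0 ≤ B) (hD : 0 ≤ D) (hm : 0 ≤ m) :
    ‖c₀ • (P₁ - U₁) + ρ • (P₂ - U₂) + fderiv ℝ f p (P - U) + (c - c') • p₁‖ ≤
      τ * (B ^ 2 + B * D + 2 * Lf * D + D + 1 + B ^ 2 * Kg + B * Kg + Kg * D) *
        (‖P - U‖ + ‖P₁ - U₁‖ + ‖P₂ - U₂‖ + (|c - c'| + |b - b'|) * m) := by
  have τ0 : 0 ≤ τ := (sq_nonneg σ).trans hσ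
  have s0 := sq_nonneg σ
  have K0 := hg.pos.le
  have id1 : c₀ • (P₁ - U₁) + ρ • (P₂ - U₂) + fderiv ℝ f p (P - U) + (c - c') • p₁ =
      -((σ ^ 2 / 2 * b ^ 2) • (P₂ - U₂) + (σ ^ 2 / 2 * (b ^ 2 - b' ^ 2)) • U₂ +
        (f P - f U - fderiv ℝ f p (P - U)) + (c - c') • (U₁ - p₁) + (c - c₀) • (P₁ - U₁) +
        (σ ^ 2 * b) • (fderiv ℝ g P - fderiv ℝ g U) P₁ + (σ ^ 2 * b) • fderiv ℝ g U (P₁ - U₁) +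
        (σ ^ 2 * (b - b')) • fderiv ℝ g U U₁) := by
    have k : ∀ b : ℝ, ρ * (1 + 1 / (2 * ρ) * σ ^ 2 * b ^ 2) = ρ + σ ^ 2 / 2 * b ^ 2 := by
      intro b; field_simp
    rw [k] at eP eU
    have e := eP.trans eU.symm
    rw [← sub_eq_zero] at e
    rw [← sub_eq_zero, ← e]
    simp only [map_sub, sub_apply]
    module
  rw [id1, norm_neg]
  set v := ‖P - U‖ with hv
  set v₁ := ‖P₁ - U₁‖ with hv₁
  set v₂ := ‖P₂ - U₂‖ with hv₂
  set a := |c - c'| with ha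
  set β := |b - b'| with hβ
  have v0 : 0 ≤ v := norm_nonneg _
  have v10 : 0 ≤ v₁ := norm_nonneg _
  have v20 : 0 ≤ v₂ := norm_nonneg _
  have a0 : 0 ≤ a := abs_nonneg _
  have β0 : 0 ≤ β := abs_nonneg _
  have Dm : 0 ≤ D * m := mul_nonneg hD hm
  have t1 : ‖(σ ^ 2 / 2 * b ^ 2) • (P₂ - U₂)‖ ≤ τ * (B ^ 2 * v₂) := by
    rw [norm_smul, Real.norm_of_nonneg (by positivity), ← mul_assoc]
    refine mul_le_mul_of_nonneg_right ?_ v20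
    have : b ^ 2 ≤ B ^ 2 := by rw [← sq_abs]; exact pow_le_pow_left₀ (abs_nonneg b) hb 2
    exact mul_le_mul (by linarith) this (sq_nonneg _) τ0
  have t2 : ‖(σ ^ 2 / 2 * (b ^ 2 - b' ^ 2)) • U₂‖ ≤ τ * (B * D * (β * m)) := by
    have e : b ^ 2 - b' ^ 2 = (b + b') * (b - b') := by ring
    rw [norm_smul, e, Real.norm_eq_abs, abs_mul, abs_mul, abs_of_nonneg (by positivity)]
    have h1 : |b + b'| ≤ 2 * B := (abs_add_le _ _).trans (by linarith)
    have h2 : σ ^ 2 / 2 * (|b + b'| * β) ≤ τ / 2 * (2 * B * β) :=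
      mul_le_mul (by linarith) (mul_le_mul_of_nonneg_right h1 β0) (by positivity) (by linarith)
    refine (mul_le_mul h2 hU₂ (norm_nonneg _) (by positivity)).trans (le_of_eq (by ring))
  have t3 : ‖f P - f U - fderiv ℝ f p (P - U)‖ ≤ τ * (2 * Lf * D * v) := by
    refine (norm_taylor_le df hLf lip hP hU hp).trans ?_
    have : Lf * (v + ‖U - p‖) ≤ Lf * (2 * (D * τ)) :=
      mul_le_mul_of_nonneg_left (by linarith) hLf
    exact (mul_le_mul_of_nonneg_right this v0).trans (le_of_eq (by ring))
  have t4 : ‖(c - c') • (U₁ - p₁)‖ ≤ τ * (D * (a * m)) := by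
    rw [norm_smul, Real.norm_eq_abs]
    exact (mul_le_mul_of_nonneg_left hU₁p a0).trans (le_of_eq (by ring))
  have t5 : ‖(c - c₀) • (P₁ - U₁)‖ ≤ τ * v₁ := by
    rw [norm_smul, Real.norm_eq_abs]
    exact mul_le_mul_of_nonneg_right hc v10
  have sb : ‖σ ^ 2 * b‖ ≤ τ * B := by
    rw [norm_mul, Real.norm_of_nonneg s0, Real.norm_eq_abs]
    exact mul_le_mul hσ hb (abs_nonneg _) τ0
  have τB : 0 ≤ τ * B := mul_nonneg τ0 hB
  have t6 : ‖(σ ^ 2 * b) • (fderiv ℝ g P - fderiv ℝ g U) P₁‖ ≤ τ * (B ^ 2 * Kg * v) := by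
    rw [norm_smul]
    have h1 : ‖(fderiv ℝ g P - fderiv ℝ g U) P₁‖ ≤ (Kg * v) * B :=
      (ContinuousLinearMap.le_opNorm _ _).trans
        (mul_le_mul (hg.norm_fderiv_sub_le P U) hP₁ (norm_nonneg _) (by positivity))
    exact (mul_le_mul sb h1 (norm_nonneg _) τB).trans (le_of_eq (by ring))
  have t7 : ‖(σ ^ 2 * b) • fderiv ℝ g U (P₁ - U₁)‖ ≤ τ * (B * Kg * v₁) := by
    rw [norm_smul]
    have h1 : ‖fderiv ℝ g U (P₁ - U₁)‖ ≤ Kg * v₁ :=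
      (ContinuousLinearMap.le_opNorm _ _).trans (mul_le_mul_of_nonneg_right (hg.bound U) v10)
    exact (mul_le_mul sb h1 (norm_nonneg _) τB).trans (le_of_eq (by ring))
  have t8 : ‖(σ ^ 2 * (b - b')) • fderiv ℝ g U U₁‖ ≤ τ * (Kg * D * (β * m)) := by
    rw [norm_smul, norm_mul, Real.norm_of_nonneg s0, Real.norm_eq_abs]
    have h1 : ‖fderiv ℝ g U U₁‖ ≤ Kg * (D * m) :=
      (ContinuousLinearMap.le_opNorm _ _).trans
        (mul_le_mul (hg.bound U) hU₁ (norm_nonneg _) K0)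
    exact (mul_le_mul (mul_le_mul_of_nonneg_right hσ β0) h1 (norm_nonneg _)
      (mul_nonneg τ0 β0)).trans (le_of_eq (by ring))
  have am0 : 0 ≤ a * m := mul_nonneg a0 hm
  have βm0 : 0 ≤ β * m := mul_nonneg β0 hm
  have total := norm_add_le_of_le (norm_add_le_of_le (norm_add_le_of_le (norm_add_le_of_le
    (norm_add_le_of_le (norm_add_le_of_le (norm_add_le_of_le t1 t2) t3) t4) t5) t6) t7) t8
  refine total.trans ?_
  set A := B ^ 2 + B * D + 2 * Lf * D + D + 1 + B ^ 2 * Kg + B * Kg + Kg * D with hA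
  have x1 : 0 ≤ B ^ 2 := by positivity
  have x2 : 0 ≤ B * D := by positivity
  have x3 : 0 ≤ 2 * Lf * D := by positivity
  have x4 : 0 ≤ B ^ 2 * Kg := by positivity
  have x5 : 0 ≤ B * Kg := by positivity
  have x6 : 0 ≤ Kg * D := by positivity
  have y1 : B ^ 2 * v₂ ≤ A * v₂ := mul_le_mul_of_nonneg_right (by linarith) v20
  have y2 : (B * D + Kg * D) * (β * m) ≤ A * (β * m) :=
    mul_le_mul_of_nonneg_right (by linarith) βm0
  have y3 : (2 * Lf * D + B ^ 2 * Kg) * v ≤ A * v := mul_le_mul_of_nonneg_right (by linarith) v0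
  have y4 : D * (a * m) ≤ A * (a * m) := mul_le_mul_of_nonneg_right (by linarith) am0
  have y5 : (1 + B * Kg) * v₁ ≤ A * v₁ := mul_le_mul_of_nonneg_right (by linarith) v10
  have y : B ^ 2 * v₂ + (B * D + Kg * D) * (β * m) + (2 * Lf * D + B ^ 2 * Kg) * v +
      D * (a * m) + (1 + B * Kg) * v₁ ≤ A * (v + v₁ + v₂ + (a + β) * m) := by
    have : A * (v + v₁ + v₂ + (a + β) * m) =
      A * v₂ + A * (β * m) + A * v + A * (a * m) + A * v₁ := by ring
    rw [this]
    linarith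
  have z := mul_le_mul_of_nonneg_left y τ0
  refine le_trans (le_of_eq (by ring)) (z.trans (le_of_eq (by ring)))

/-- The values of `b` at a modified wave and at the dilated wave differ by at most a multiple of
their distance in `H¹`: on the dilated wave, `g` is exactly proportional to the derivative. -/
theorem abs_b_sub_le {Φ Φ₁ U U₁ : ℝ → E n} {μ bΦ : ℝ} (hg : Hg g um up Kg) (mψ : MemLp ψ 2 volume)
    (hU : ∀ ξ, g (U ξ) = μ • U₁ ξ) (cΦ : Continuous Φ) (cU : Continuous U)
    (m0 : MemLp (fun ξ => Φ ξ - U ξ) 2 volume) (m1 : MemLp (fun ξ => Φ₁ ξ - U₁ ξ) 2 volume)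
    (mΦ₁ : MemLp Φ₁ 2 volume) (mg : MemLp (fun ξ => g (Φ ξ)) 2 volume)
    (h1 : 1 / 2 ≤ innerL2 Φ₁ ψ)
    (hb : bΦ = -((innerL2 Φ₁ ψ)⁻¹ * innerL2 (fun ξ => g (Φ ξ)) ψ)) :
    |bΦ - -μ| ≤ 2 * (Kg + |μ|) * nrm ψ *
      (nrm (fun ξ => Φ ξ - U ξ) + nrm (fun ξ => Φ₁ ξ - U₁ ξ)) := by
  set I := innerL2 Φ₁ ψ with hI
  have I0 : 0 < I := by linarith
  obtain ⟨q1, q2⟩ := hg.memLp_comp_sub cΦ cU m0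
  have e : bΦ - -μ = -(I⁻¹ * innerL2 (fun ξ => (g (Φ ξ) - g (U ξ)) - μ • (Φ₁ ξ - U₁ ξ)) ψ) := by
    have : (fun ξ => (g (Φ ξ) - g (U ξ)) - μ • (Φ₁ ξ - U₁ ξ)) =
        fun ξ => g (Φ ξ) - μ • Φ₁ ξ := by
      funext ξ
      rw [hU]
      module
    rw [this, innerL2_sub_left mg (memLp_smul μ mΦ₁) mψ, innerL2_smul_left, ← hI, hb]
    field_simp
    ring
  have h2 : |innerL2 (fun ξ => (g (Φ ξ) - g (U ξ)) - μ • (Φ₁ ξ - U₁ ξ)) ψ| ≤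
      (Kg * nrm (fun ξ => Φ ξ - U ξ) + |μ| * nrm (fun ξ => Φ₁ ξ - U₁ ξ)) * nrm ψ := by
    rw [innerL2_sub_left q1 (memLp_smul μ m1) mψ, innerL2_smul_left]
    refine (abs_sub _ _).trans ?_
    rw [abs_mul, add_mul]
    refine add_le_add ((abs_innerL2_le q1 mψ).trans
      (mul_le_mul_of_nonneg_right q2 (nrm_nonneg _))) ?_
    rw [mul_assoc]
    exact mul_le_mul_of_nonneg_left (abs_innerL2_le m1 mψ) (abs_nonneg _)
  have h3 : |I⁻¹| ≤ 2 := by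
    rw [abs_of_pos (inv_pos.2 I0), inv_le_comm₀ I0 (by norm_num)]
    linarith
  rw [e, abs_neg, abs_mul]
  have n0 := nrm_nonneg (fun ξ => Φ ξ - U ξ)
  have n1 := nrm_nonneg (fun ξ => Φ₁ ξ - U₁ ξ)
  refine (mul_le_mul h3 h2 (abs_nonneg _) (by norm_num)).trans ?_
  have k : Kg * nrm (fun ξ => Φ ξ - U ξ) + |μ| * nrm (fun ξ => Φ₁ ξ - U₁ ξ) ≤
      (Kg + |μ|) * (nrm (fun ξ => Φ ξ - U ξ) + nrm (fun ξ => Φ₁ ξ - U₁ ξ)) := by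
    nlinarith [mul_nonneg hg.pos.le n1, mul_nonneg (abs_nonneg μ) n0]
  calc _ ≤ 2 * ((Kg + |μ|) * (nrm (fun ξ => Φ ξ - U ξ) + nrm (fun ξ => Φ₁ ξ - U₁ ξ)) * nrm ψ) :=
        mul_le_mul_of_nonneg_left (mul_le_mul_of_nonneg_right k (nrm_nonneg _)) (by norm_num)
    _ = _ := by ring

theorem nrm_le_of_pointwise {R v w z : ℝ → E n} {m : ℝ → ℝ} {k s : ℝ} (hk : 0 ≤ k) (hs : 0 ≤ s)
    (mv : MemLp v 2 volume) (mw : MemLp w 2 volume) (mz : MemLp z 2 volume)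
    (mm : MemLp m 2 volume) (h : ∀ ξ, ‖R ξ‖ ≤ k * (‖v ξ‖ + ‖w ξ‖ + ‖z ξ‖ + s * m ξ)) :
    nrm R ≤ k * (nrm v + nrm w + nrm z + s * nrm m) := by
  have m1 : MemLp (fun ξ => ‖v ξ‖ + ‖w ξ‖) 2 volume := mv.norm.add mw.norm
  have m2 : MemLp (fun ξ => ‖v ξ‖ + ‖w ξ‖ + ‖z ξ‖) 2 volume := m1.add mz.norm
  have m3 : MemLp (fun ξ => s * m ξ) 2 volume := mm.const_mul s
  have m4 : MemLp (fun ξ => ‖v ξ‖ + ‖w ξ‖ + ‖z ξ‖ + s * m ξ) 2 volume := m2.add m3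
  have hm : ∀ (a : ℝ) (u : ℝ → ℝ), 0 ≤ a → nrm (fun ξ => a * u ξ) = a * nrm u := fun a u ha => by
    rw [← abs_of_nonneg ha, ← nrm_smul, abs_of_nonneg ha]
    rfl
  refine (nrm_mono (m4.const_mul k) (Eventually.of_forall h)).trans ?_
  rw [hm _ _ hk]
  refine mul_le_mul_of_nonneg_left ?_ hk
  have k1 := nrm_add_le mv.norm mw.norm
  have k2 := nrm_add_le m1 mz.norm
  have k3 := nrm_add_le m2 m3
  rw [nrm_norm] at k2
  rw [nrm_norm, nrm_norm] at k1
  rw [hm _ _ hs] at k3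
  linarith

/-- Absorption: if the linearised operator, applied to `v` and shifted by `a φ₁`, is bounded by a
small multiple of `v`, `a` and a quantity `β` that is itself controlled by `v`, then all of them
vanish. -/
theorem eq_zero_of_coercive {B : ℝ → E n →L[ℝ] E n} {C₀ k S a β : ℝ} (hC₀ : 0 ≤ C₀)
    (coer : ∀ v w z : ℝ → E n, HasWeakDeriv v w → HasWeakDeriv w z →
      MemLp v 2 volume → MemLp w 2 volume → MemLp z 2 volume → innerL2 v ψ = 0 → ∀ a : ℝ,
      nrm v + nrm w + nrm z + |a| ≤
        C₀ * nrm (fun ξ => c₀ • w ξ + ρ • z ξ + B ξ (v ξ) + a • φ₁ ξ))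
    {v v₁ v₂ : ℝ → E n} {m : ℝ → ℝ} (hv : IsC2H2 v v₁ v₂) (mm : MemLp m 2 volume)
    (hk : 0 ≤ k) (hS : 0 ≤ S) (horth : innerL2 v ψ = 0)
    (pw : ∀ ξ, ‖c₀ • v₁ ξ + ρ • v₂ ξ + B ξ (v ξ) + a • φ₁ ξ‖ ≤
      k * (‖v ξ‖ + ‖v₁ ξ‖ + ‖v₂ ξ‖ + (|a| + |β|) * m ξ))
    (hβ : |β| ≤ S * (nrm v + nrm v₁)) (small : C₀ * k * (1 + (1 + S) * nrm m) ≤ 1 / 2) :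
    (∀ ξ, v ξ = 0) ∧ a = 0 ∧ β = 0 := by
  have hR := nrm_le_of_pointwise hk (add_nonneg (abs_nonneg a) (abs_nonneg β)) hv.memLp0 hv.memLp1
    hv.memLp2 mm pw
  have hcoer := (coer _ _ _ hv.hasWeakDeriv0 hv.hasWeakDeriv1 hv.memLp0 hv.memLp1 hv.memLp2
    horth a).trans (mul_le_mul_of_nonneg_left hR hC₀)
  have N0 := nrm_nonneg v
  have N1 := nrm_nonneg v₁
  have N2 := nrm_nonneg v₂
  have W0 := nrm_nonneg m
  have a0 := abs_nonneg a
  have β0 := abs_nonneg β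
  obtain ⟨N, hN⟩ : ∃ N, N = nrm v + nrm v₁ + nrm v₂ + |a| := ⟨_, rfl⟩
  have hβN : |β| ≤ S * N := hβ.trans (mul_le_mul_of_nonneg_left (by linarith) hS)
  have h2 : nrm v + nrm v₁ + nrm v₂ + (|a| + |β|) * nrm m ≤ (1 + (1 + S) * nrm m) * N := by
    have : (|a| + |β|) * nrm m ≤ ((1 + S) * N) * nrm m :=
      mul_le_mul_of_nonneg_right (by linarith) W0
    linarith
  have h3 : N ≤ 1 / 2 * N := by
    rw [hN]
    refine hcoer.trans ?_
    rw [← hN, ← mul_assoc]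
    refine (mul_le_mul_of_nonneg_left h2 (mul_nonneg hC₀ hk)).trans ?_
    rw [← mul_assoc]
    exact mul_le_mul_of_nonneg_right small (by linarith)
  have NZ : N = 0 := by linarith
  have Nv : nrm v = 0 := by linarith
  rw [NZ, mul_zero] at hβN
  refine ⟨?_, abs_eq_zero.1 (by linarith), abs_eq_zero.1 (by linarith)⟩
  have hz := nrm_eq_zero hv.memLp0 Nv
  exact congrFun ((Continuous.ae_eq_iff_eq volume hv.cont0 continuous_zero).1 hz)

/-- A modified wave whose difference from a slightly translated dilated wave is orthogonal to `ψ`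
equals that wave: the coercivity estimate absorbs the remainder. -/
theorem Profile.exists_rigid (hρ : 0 < ρ) (hf : Hf f um up)
    (hg : Hg g um up Kg) (hlow : IsCutoffLow χlow)
    (hhigh : IsCutoffHigh (Kip g Kg Φ₀ ψ) χhigh) (mψ : MemLp ψ 2 volume)
    (hp : Profile ρ f Φ₀ c₀ φ₁ φ₂ φ₃ C ν) (hψ : innerL2 φ₁ ψ = 1)
    (hθ : ∀ ξ, g (Φ₀ ξ) = θ₀ • φ₁ ξ) {C₀ : ℝ} (hC₀ : 0 < C₀)
    (coer : ∀ v w z : ℝ → E n, HasWeakDeriv v w → HasWeakDeriv w z →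
      MemLp v 2 volume → MemLp w 2 volume → MemLp z 2 volume → innerL2 v ψ = 0 → ∀ a : ℝ,
      nrm v + nrm w + nrm z + |a| ≤
        C₀ * nrm (fun ξ => c₀ • w ξ + ρ • z ξ + fderiv ℝ f (Φ₀ ξ) (v ξ) + a • φ₁ ξ)) :
    ∃ ε : ℝ, 0 < ε ∧ ε ≤ 1 ∧ ∀ (K σ α γ : ℝ) (Φ : ℝ → E n) (c : ℝ), 1 ≤ α →
      α ^ 2 = 1 + 1 / (2 * ρ) * σ ^ 2 * θ₀ ^ 2 → α - 1 ≤ ε → |γ| ≤ ε → σ ^ 2 ≤ ε →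
      K * σ ^ 2 ≤ ε → IsModifiedWave χlow χhigh ρ f g Φ₀ c₀ ψ K σ Φ c →
      innerL2 (fun ξ => Φ ξ - Φ₀ (α * (ξ - γ))) ψ = 0 →
      (∀ ξ, Φ ξ = Φ₀ (α * (ξ - γ))) ∧ c = α⁻¹ * c₀ ∧
        b χlow χhigh g Φ ψ = -(α⁻¹ * θ₀) := by
  obtain ⟨D₁, hD₁, hb⟩ := hp.exists_dilate
  have P0 : 0 ≤ nrm ψ := nrm_nonneg _
  have hC := hp.posC
  have hKg := hg.pos
  have Kip0 : 0 ≤ Kip g Kg Φ₀ ψ :=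
    mul_nonneg (add_nonneg (nrm_nonneg _) (by linarith)) P0
  have cdf : ContDiff ℝ 1 (fderiv ℝ f) := hf.contDiff.fderiv_right (by norm_num)
  obtain ⟨Lf, hLf, lip⟩ := exists_lipschitz_on_ball cdf (C + 2)
  have W0 : 0 ≤ nrm (weight (ν / 2)) := nrm_nonneg _
  have mW := memLp_weight (half_pos hp.posν)
  obtain ⟨D, hD⟩ : ∃ D, D = D₁ + 2 := ⟨_, rfl⟩
  have D0 : 0 < D := by linarith
  obtain ⟨B, hB⟩ : ∃ B, B = 2 * Kip g Kg Φ₀ ψ + |θ₀| + C + 2 := ⟨_, rfl⟩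
  have B0 : 0 ≤ B := by rw [hB]; positivity
  obtain ⟨A, hA⟩ : ∃ A, A = B ^ 2 + B * D + 2 * Lf * D + D + 1 + B ^ 2 * Kg + B * Kg + Kg * D :=
    ⟨_, rfl⟩
  have A0 : 0 < A := by rw [hA]; positivity
  obtain ⟨S, hS⟩ : ∃ S, S = 2 * (Kg + |θ₀|) * nrm ψ := ⟨_, rfl⟩
  have S0 : 0 ≤ S := by rw [hS]; positivity
  obtain ⟨T, hT⟩ : ∃ T, T = C₀ * A * (1 + (1 + S) * nrm (weight (ν / 2))) := ⟨_, rfl⟩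
  have T0 : 0 ≤ T := by rw [hT]; positivity
  obtain ⟨ε, ε0, ε1, εT, εψ⟩ : ∃ ε : ℝ, 0 < ε ∧ ε ≤ 1 ∧ T * (4 * ε) ≤ 1 / 2 ∧
      ε * nrm ψ ≤ 1 / 2 := by
    refine ⟨1 / (8 * (T + nrm ψ + 1)), by positivity, ?_, ?_, ?_⟩
    · rw [div_le_one (by positivity)]; linarith
    · rw [mul_one_div, mul_div_assoc', div_le_div_iff₀ (by positivity) (by norm_num)]; linarith
    · rw [div_mul_eq_mul_div, div_le_div_iff₀ (by positivity) (by norm_num)]; linarith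
  refine ⟨ε, ε0, ε1, ?_⟩
  intro K σ α γ Φ c hα hα2 hαε hγ hσ hK hΦ horth
  have α0 : α ≠ 0 := by linarith
  have hα' : α ≤ 2 := by linarith
  have hγ1 : |γ| ≤ 1 := hγ.trans ε1
  have bound := hΦ.bound
  obtain ⟨Φ₁, Φ₂, dΦ, dΦ₁, hV, ode⟩ := hΦ.exists_classical hρ.ne' hf.contDiff.continuous
    (hg.contDiff.of_le (by norm_num)) hp
  have cΦ := hΦ.continuous
  change normH2 (fun ξ => Φ ξ - Φ₀ ξ) + |c - c₀| ≤ K * σ ^ 2 at bound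
  obtain ⟨n0, n1, n2⟩ := hV.le_normH2
  have nH0 : 0 ≤ normH2 (fun ξ => Φ ξ - Φ₀ ξ) := Real.sqrt_nonneg _
  have hc : |c - c₀| ≤ K * σ ^ 2 := by linarith
  have hN : normH2 (fun ξ => Φ ξ - Φ₀ ξ) ≤ K * σ ^ 2 := by linarith [abs_nonneg (c - c₀)]
  have Kσ0 : 0 ≤ K * σ ^ 2 := nH0.trans hN
  have cΦ₁ : Continuous Φ₁ := continuous_iff_continuousAt.2 fun ξ => (dΦ₁ ξ).continuousAt
  obtain ⟨i1, i2, eb, mΦ₁, mg⟩ := b_eq_of_near hg hlow hhigh mψ hp hψ hθ dΦ cΦ₁ hV.memLp0 hV.memLp1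
    (by linarith) ((mul_le_mul_of_nonneg_right (n1.trans (hN.trans hK)) P0).trans εψ)
  unfold kappa at ode
  clear bound hΦ
  generalize b χlow χhigh g Φ ψ = bΦ at eb ode ⊢
  have supV := norm_le_nrm_add_nrm hV.d0 hV.cont1 hV.memLp0 hV.memLp1
  have supV₁ := norm_le_nrm_add_nrm hV.d1 hV.cont2 hV.memLp1 hV.memLp2
  have supV' : ∀ ξ, ‖Φ ξ - Φ₀ ξ‖ ≤ 2 * (K * σ ^ 2) := fun ξ => by linarith [supV ξ]
  have supV₁' : ∀ ξ, ‖Φ₁ ξ - φ₁ ξ‖ ≤ 2 * (K * σ ^ 2) := fun ξ => by linarith [supV₁ ξ]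
  clear supV supV₁ n0 n1 n2 nH0 hN
  have s0 := sq_nonneg σ
  have γ0 := abs_nonneg γ
  obtain ⟨q, hq⟩ : ∃ q, q = (α - 1) + |γ| := ⟨_, rfl⟩
  have q0 : 0 ≤ q := by linarith
  obtain ⟨τ, hτ⟩ : ∃ τ, τ = q + σ ^ 2 + K * σ ^ 2 := ⟨_, rfl⟩
  have τ0 : 0 ≤ τ := by linarith
  have τε : τ ≤ 4 * ε := by linarith
  have dU := fun ξ => hp.hasDerivAt_dilate α γ ξ
  have cU : Continuous fun ξ => Φ₀ (α * (ξ - γ)) :=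
    continuous_iff_continuousAt.2 fun ξ => (dU ξ).1.continuousAt
  have hv := hV.sub (hp.isC2H2_dilate hα hα' hγ1)
  simp only [sub_sub_sub_cancel_right] at hv
  have odeU := fun ξ => hp.dilate_ode (σ := σ) (γ := γ) hρ hα hα2
    (hg.contDiff.differentiable (by norm_num)) hθ ξ
  have hgU := fun ξ => g_dilate (γ := γ) α0 hθ ξ
  have bμ : |α⁻¹ * θ₀| ≤ |θ₀| := by
    rw [abs_mul, abs_of_nonneg (by positivity)]
    exact mul_le_of_le_one_left (abs_nonneg _) (inv_le_one_of_one_le₀ hα)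
  have hβ := abs_b_sub_le hg mψ hgU cΦ cU hv.memLp0 hv.memLp1 mΦ₁ mg i1 eb
  have bB : |bΦ| ≤ B := by
    rw [eb, abs_neg, abs_mul, abs_of_pos (inv_pos.2 (by linarith))]
    have : (innerL2 Φ₁ ψ)⁻¹ ≤ 2 := by
      rw [inv_le_comm₀ (by linarith) (by norm_num)]; linarith
    have := mul_le_mul this i2 (abs_nonneg _) (by norm_num)
    linarith [abs_nonneg θ₀]
  have ode' : ∀ ξ, (ρ * (1 + 1 / (2 * ρ) * σ ^ 2 * bΦ ^ 2)) • Φ₂ ξ +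
      (f (Φ ξ) + c • Φ₁ ξ + (σ ^ 2 * bΦ) • fderiv ℝ g (Φ ξ) (Φ₁ ξ)) = 0 := by
    intro ξ
    have κ0 : 0 < 1 + 1 / (2 * ρ) * σ ^ 2 * bΦ ^ 2 := by positivity
    have h := ode ξ
    generalize 1 + 1 / (2 * ρ) * σ ^ 2 * bΦ ^ 2 = κ at κ0 h ⊢
    have := congrArg (fun x => κ • x) h
    simp only [smul_zero] at this
    rw [smul_add, smul_smul, smul_smul, mul_inv_cancel₀ κ0.ne', one_smul, mul_comm κ ρ] at this
    exact this
  clear ode i1 i2 eb dΦ dΦ₁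
  have pw : ∀ ξ, ‖c₀ • (Φ₁ ξ - α • φ₁ (α * (ξ - γ))) +
      ρ • (Φ₂ ξ - (α * α) • φ₂ (α * (ξ - γ))) +
      fderiv ℝ f (Φ₀ ξ) (Φ ξ - Φ₀ (α * (ξ - γ))) + (c - α⁻¹ * c₀) • φ₁ ξ‖ ≤
      (τ * A) * (‖Φ ξ - Φ₀ (α * (ξ - γ))‖ + ‖Φ₁ ξ - α • φ₁ (α * (ξ - γ))‖ +
        ‖Φ₂ ξ - (α * α) • φ₂ (α * (ξ - γ))‖ +
        (|c - α⁻¹ * c₀| + |bΦ - -(α⁻¹ * θ₀)|) * weight (ν / 2) ξ) := by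
    intro ξ
    obtain ⟨u0, u1, -, u3, u4⟩ := hb α γ hα hα' hγ1 ξ
    rw [← hq] at u0 u1
    have m0 := weight_pos (ν / 2) ξ
    have m1 := weight_le_one (half_pos hp.posν).le ξ
    have w0 := hp.bound0 ξ
    have w1 : ‖φ₁ ξ‖ ≤ C :=
      (hp.bound1 ξ).trans (mul_le_of_le_one_right hC.le (weight_le_one hp.posν.le ξ))
    have DD : D₁ ≤ D := by linarith
    have qτ : q ≤ τ := by linarith
    have u0' : ‖Φ₀ (α * (ξ - γ)) - Φ₀ ξ‖ ≤ D₁ * τ :=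
      u0.trans ((mul_le_of_le_one_right (mul_nonneg hD₁.le q0) m1).trans
        (mul_le_mul_of_nonneg_left qτ hD₁.le))
    have x0 : ‖Φ ξ‖ ≤ C + 2 := by
      linarith [norm_le_norm_sub_add (Φ ξ) (Φ₀ ξ), supV' ξ]
    have x1 : ‖Φ₁ ξ‖ ≤ B := by
      linarith [norm_le_norm_sub_add (Φ₁ ξ) (φ₁ ξ), supV₁' ξ, abs_nonneg θ₀]
    have x2 : ‖Φ ξ - Φ₀ (α * (ξ - γ))‖ ≤ D * τ := by
      have h1 := norm_sub_le_norm_sub_add_norm_sub (Φ ξ) (Φ₀ ξ) (Φ₀ (α * (ξ - γ)))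
      rw [norm_sub_rev (Φ₀ ξ)] at h1
      have h2 : D * τ = D₁ * τ + 2 * τ := by rw [hD]; ring
      linarith [supV' ξ]
    rw [hA]
    exact norm_remainder_le hρ (hf.contDiff.differentiable (by norm_num)) hLf.le lip hg (ode' ξ)
      (odeU ξ) x0 ((hp.bound0 _).trans (by linarith)) (w0.trans (by linarith)) bB
      (by rw [abs_neg]; linarith) x1 x2 (u0'.trans (mul_le_mul_of_nonneg_right DD τ0))
      (u3.trans (mul_le_mul_of_nonneg_right DD m0.le))
      (u4.trans (mul_le_mul_of_nonneg_right DD m0.le))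
      (u1.trans (mul_le_mul_of_nonneg_right (mul_le_mul DD qτ q0 D0.le) m0.le))
      (by linarith) (by linarith) B0 D0.le m0.le
  have small : C₀ * (τ * A) * (1 + (1 + S) * nrm (weight (ν / 2))) ≤ 1 / 2 := by
    have h1 : T * τ ≤ 1 / 2 := (mul_le_mul_of_nonneg_left τε T0).trans εT
    rw [hT] at h1
    refine le_trans (le_of_eq ?_) h1
    ring
  have hβS : |bΦ - -(α⁻¹ * θ₀)| ≤ S * (nrm (fun ξ => Φ ξ - Φ₀ (α * (ξ - γ))) +
      nrm (fun ξ => Φ₁ ξ - α • φ₁ (α * (ξ - γ)))) := by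
    refine hβ.trans (mul_le_mul_of_nonneg_right ?_ (add_nonneg (nrm_nonneg _) (nrm_nonneg _)))
    rw [hS]
    exact mul_le_mul_of_nonneg_right (by linarith) P0
  obtain ⟨z0, z1, z2⟩ := eq_zero_of_coercive hC₀.le coer hv mW (mul_nonneg τ0 A0.le) S0 horth pw
    hβS small
  exact ⟨fun ξ => sub_eq_zero.1 (z0 ξ), sub_eq_zero.1 z1, sub_eq_zero.1 z2⟩

end

end StochWave

theorem proposition2p6 {n : ℕ} (ρ : ℝ) (hρ : 0 < ρ)
    (f g : StochWave.E n → StochWave.E n) (um up : StochWave.E n)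
    (Φ₀ : ℝ → StochWave.E n) (c₀ : ℝ) (ψ : ℝ → StochWave.E n) (Kg : ℝ)
    (hf : StochWave.Hf f um up)
    (hTw : StochWave.HTw ρ f um up Φ₀ c₀)
    (hS : StochWave.HS ρ f Φ₀ c₀ ψ)
    (hg : StochWave.Hg g um up Kg)
    (χlow χhigh : ℝ → ℝ)
    (hlow : StochWave.IsCutoffLow χlow)
    (hhigh : StochWave.IsCutoffHigh (StochWave.Kip g Kg Φ₀ ψ) χhigh)
    (θ₀ : ℝ) (hθ : ∀ ξ, g (Φ₀ ξ) = θ₀ • deriv Φ₀ ξ) :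
    ∃ K₀ : ℝ, 0 < K₀ ∧ ∀ K : ℝ, K₀ ≤ K → ∃ δ : ℝ, 0 < δ ∧ ∀ σ : ℝ, 0 ≤ σ → σ ≤ δ →
      ∀ α : ℝ, α = (1 + 1 / (2 * ρ) * σ ^ 2 * θ₀ ^ 2) ^ (1 / 2 : ℝ) →
        StochWave.IsModifiedWave χlow χhigh ρ f g Φ₀ c₀ ψ K σ
          (fun ξ => Φ₀ (α * ξ)) (α⁻¹ * c₀) ∧
        ∀ (Φ : ℝ → StochWave.E n) (c : ℝ),
          StochWave.IsModifiedWave χlow χhigh ρ f g Φ₀ c₀ ψ K σ Φ c →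
            (∃ γ : ℝ, ∀ ξ, Φ ξ = Φ₀ (α * (ξ - γ))) ∧
            (StochWave.innerL2 (fun ξ => Φ ξ - Φ₀ (α * ξ)) ψ = 0 → ∀ ξ, Φ ξ = Φ₀ (α * ξ)) ∧
            c = α⁻¹ * c₀ ∧
            ∀ ξ, g (Φ ξ) = (α⁻¹ * θ₀) • deriv Φ ξ ∧
              (α⁻¹ * θ₀) • deriv Φ ξ = -StochWave.b χlow χhigh g Φ ψ • deriv Φ ξ := by
  obtain ⟨φ₃, C, ν, hp⟩ := hTw.exists_profile hρ hf
  obtain ⟨L, Ladj, hL, hadj, -, fred, kL, kadj, hψ⟩ := hS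
  have mψ : MemLp ψ 2 volume := by
    obtain ⟨ψ', e, -⟩ := kadj
    exact (memLp_congr_ae e).1 (Lp.memLp _)
  obtain ⟨M, hM⟩ : ∃ M, ∀ x ∈ Metric.closedBall (0 : StochWave.E n) C, ‖fderiv ℝ f x‖ ≤ M :=
    (isCompact_closedBall _ _).exists_bound_of_continuousOn
      (hf.contDiff.continuous_fderiv (by norm_num)).continuousOn
  obtain ⟨C₀, hC₀, coer⟩ := StochWave.exists_coercive hL hadj
    (fun ξ => hM (Φ₀ ξ) (by simpa using hp.bound0 ξ)) fred kL kadj hψ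
  obtain ⟨K₀, hK₀, ε₁, hε₁, wave⟩ :=
    hp.exists_isModifiedWave_dilate hρ hg hlow hhigh mψ hψ hθ
  obtain ⟨ε₂, hε₂, hε₂1, rigid⟩ :=
    hp.exists_rigid hρ hf hg hlow hhigh mψ hψ hθ hC₀ coer
  obtain ⟨ε₃, hε₃, phase⟩ := hp.exists_phase mψ hψ hε₂ hε₂1
  refine ⟨K₀, hK₀, fun K hK => ?_⟩
  set t := θ₀ ^ 2 / (2 * ρ) with ht
  have t0 : 0 ≤ t := by positivity
  have K0 : 0 < K := by linarith
  set ε := min ε₁ (min ε₂ ε₃) with hε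
  have ε0 : 0 < ε := lt_min hε₁ (lt_min hε₂ hε₃)
  have e1 : ε ≤ ε₁ := min_le_left _ _
  have e2 : ε ≤ ε₂ := (min_le_right _ _).trans (min_le_left _ _)
  have e3 : ε ≤ ε₃ := (min_le_right _ _).trans (min_le_right _ _)
  refine ⟨Real.sqrt (ε / (1 + t + K)), Real.sqrt_pos.2 (by positivity), ?_⟩
  intro σ hσ0 hσ α hα
  have s0 := sq_nonneg σ
  have hsq : (1 + t + K) * σ ^ 2 ≤ ε := by
    have := (Real.le_sqrt hσ0 (by positivity)).1 hσ
    rw [le_div_iff₀ (by positivity)] at this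
    linarith
  have tσ : 0 ≤ t * σ ^ 2 := by positivity
  have Kσ : 0 ≤ K * σ ^ 2 := by positivity
  have r0 : 0 ≤ 1 / (2 * ρ) * σ ^ 2 * θ₀ ^ 2 := by positivity
  have α1 : 1 ≤ α := by
    rw [hα]; exact Real.one_le_rpow (by linarith) (by norm_num)
  have α2 : α ^ 2 = 1 + 1 / (2 * ρ) * σ ^ 2 * θ₀ ^ 2 := by
    rw [hα, ← Real.sqrt_eq_rpow, Real.sq_sqrt (by linarith)]
  have αt := StochWave.dilation_le α1 α2
  rw [← ht] at αt
  refine ⟨wave K σ α hK α1 (by linarith) α2, fun Φ c hΦ => ?_⟩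
  have close : ∀ γ, |γ| ≤ ε₂ → StochWave.innerL2 (fun ξ => Φ ξ - Φ₀ (α * (ξ - γ))) ψ = 0 →
      (∀ ξ, Φ ξ = Φ₀ (α * (ξ - γ))) ∧ c = α⁻¹ * c₀ ∧
        StochWave.b χlow χhigh g Φ ψ = -(α⁻¹ * θ₀) := fun γ hγ h =>
    rigid K σ α γ Φ c α1 α2 (by linarith) hγ (by linarith) (by linarith) hΦ h
  obtain ⟨Φ₁, Φ₂, -, -, hV, -⟩ := hΦ.exists_classical hρ.ne' hf.contDiff.continuous
    (hg.contDiff.of_le (by norm_num)) hp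
  have nΦ : StochWave.nrm (fun ξ => Φ ξ - Φ₀ ξ) ≤ ε₃ := by
    have h1 := hV.le_normH2.1
    have h2 := hΦ.bound
    change StochWave.normH2 (fun ξ => Φ ξ - Φ₀ ξ) + _ ≤ _ at h2
    linarith [abs_nonneg (c - c₀)]
  obtain ⟨γ, hγ, horth⟩ := phase α Φ α1 (by linarith) (by linarith) hV.memLp0 nΦ
  obtain ⟨eΦ, ec, eb⟩ := close γ hγ horth
  refine ⟨⟨γ, eΦ⟩, fun h ξ => ?_, ec, fun ξ => ?_⟩
  · have := (close 0 (by simpa using hε₂.le) (by simpa using h)).1 ξ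
    simpa using this
  · have hd : deriv Φ ξ = α • deriv Φ₀ (α * (ξ - γ)) := by
      rw [funext eΦ]
      exact (hp.hasDerivAt_dilate α γ ξ).1.deriv
    refine ⟨?_, by rw [eb, neg_neg]⟩
    rw [hd, eΦ ξ]
    exact StochWave.g_dilate (by linarith) hθ ξ
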